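/- For a nonempty closed set $F\subset\mathbb R^2$ let $d_F(x)=\operatorname{dist}(x,F)$. A point $a\in\mathbb R^2$ is a critical point of $d_F$ if $0$ belongs to the Clarke subdifferential of $d_F$ at $a$, i.e. if $$\limsup_{z\to a,\ t\to 0+}\frac{d_F(z+tv)-d_F(z)}{t}\ \ge 0\qquad\text{for every } v\in\mathbb R^2 ,$$ and $\operatorname{cv}(d_F)\subset\mathbb R$ denotes the set of critical values, i.e. of the values of $d_F$ at its critical points. For a nonempty bounded $A\subset\mathbb R$ and $\varepsilon>0$ let $A_\varepsilon$ be the set of points at distance at most $\varepsilon$ from $A$. The $s$-dimensional lower and upper Minkowski contents of $A$ are the $\liminf$ and the $\limsup$ of $\lambda_1(A_\varepsilon)/\varepsilon^{1-s}$ as $\varepsilon\to0+$ ($\lambda_1$ is Lebesgue measure); if they agree, their common value is the $s$-dimensional Minkowski content of $A$. The upper Minkowski dimension $\overline{\dim}_M A$ is the infimum of all $t\ge 0$ for which the $t$-dimensional upper Minkowski content of $A$ is $0$. For a compact $B\subset\mathbb R$ and $\alpha>0$, the degree-$\alpha$ gap sum is $G_\alpha(B)=\sum_I |I|^\alpha\in[0,\infty]$,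 where $I$ runs over all bounded connected components of $\mathbb R\setminus B$ and $|I|$ is the length of $I$. Theorem. (i) If $F\subset\mathbb R^2$ is nonempty and compact, then $\operatorname{cv}(d_F)$ (which is a nonempty compact set) has zero $\tfrac45$-dimensional Minkowski content; in particular $\overline{\dim}_M(\operatorname{cv}(d_F))\le \tfrac45$. (ii) There exists a nonempty compact set $F\subset\mathbb R^2$ such that $G_{4/5}(\operatorname{cv}(d_F))=\infty$ and so $\overline{\dim}_M(\operatorname{cv}(d_F))=\tfrac45$. -/

import Mathlib

open Set Filter Topology MeasureTheory
open scoped ENNReal NNReal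

noncomputable section

/-- The Clarke derivative `f⁰(a, v) = limsup_{z → a, t → 0+} (f (z + t v) - f z) / t`, taken in the
extended reals (it is finite when `f` is Lipschitz near `a`). -/
def clarkeDeriv {E : Type*} [NormedAddCommGroup E] [NormedSpace ℝ E] (f : E → ℝ) (a v : E) :
    EReal :=
  limsup (fun p : E × ℝ => (((f (p.1 + p.2 • v) - f p.1) / p.2 : ℝ) : EReal))
    (𝓝 a ×ˢ 𝓝[>] (0 : ℝ))

/-- The Clarke subdifferential of `f` at `a`, as a set of continuous linear functionals. -/
def clarkeSubdifferential {E : Type*} [NormedAddCommGroup E] [NormedSpace ℝ E] (f : E → ℝ)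
    (a : E) : Set (E →L[ℝ] ℝ) :=
  {φ | ∀ v : E, ((φ v : ℝ) : EReal) ≤ clarkeDeriv f a v}

/-- The (Clarke) critical points of `f`. -/
def criticalPoints {E : Type*} [NormedAddCommGroup E] [NormedSpace ℝ E] (f : E → ℝ) : Set E :=
  {a | 0 ∈ clarkeSubdifferential f a}

/-- The (Clarke) critical values of `f`. -/
def criticalValues {E : Type*} [NormedAddCommGroup E] [NormedSpace ℝ E] (f : E → ℝ) : Set ℝ :=
  f '' criticalPoints f

/-- The distance function `d_F` from a set `F`. -/
def distFun {E : Type*} [NormedAddCommGroup E] (F : Set E) : E → ℝ :=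
  fun x => Metric.infDist x F

/-- The `s`-dimensional lower Minkowski content of `A ⊆ ℝ`; `Metric.cthickening ε A` is the set of
points at distance at most `ε` from `A`. -/
def lowerMinkowskiContent (s : ℝ) (A : Set ℝ) : ℝ≥0∞ :=
  liminf (fun ε : ℝ => volume (Metric.cthickening ε A) / ENNReal.ofReal (ε ^ (1 - s))) (𝓝[>] 0)

/-- The `s`-dimensional upper Minkowski content of `A ⊆ ℝ`. -/
def upperMinkowskiContent (s : ℝ) (A : Set ℝ) : ℝ≥0∞ :=
  limsup (fun ε : ℝ => volume (Metric.cthickening ε A) / ENNReal.ofReal (ε ^ (1 - s))) (𝓝[>] 0)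

/-- The `s`-dimensional Minkowski content of `A ⊆ ℝ` exists and equals `c`. -/
def HasMinkowskiContent (s : ℝ) (A : Set ℝ) (c : ℝ≥0∞) : Prop :=
  lowerMinkowskiContent s A = c ∧ upperMinkowskiContent s A = c

/-- The upper Minkowski dimension of `A ⊆ ℝ`: the infimum of all `t ≥ 0` for which the
`t`-dimensional upper Minkowski content of `A` vanishes. -/
def upperMinkowskiDim (A : Set ℝ) : ℝ≥0∞ :=
  ⨅ (t : ℝ≥0) (_ : upperMinkowskiContent (t : ℝ) A = 0), (t : ℝ≥0∞)

/-- The gaps of `B ⊆ ℝ`: the bounded connected components of `ℝ \ B`. -/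
def gaps (B : Set ℝ) : Set (Set ℝ) :=
  {I | Bornology.IsBounded I ∧ ∃ x ∈ Bᶜ, I = connectedComponentIn Bᶜ x}

/-- The degree-`α` gap sum of `B`: the sum of the `α`-th powers of the lengths of its gaps. -/
def gapSum (α : ℝ) (B : Set ℝ) : ℝ≥0∞ :=
  ∑' I : gaps B, volume (I : Set ℝ) ^ α

end

/-! Upper bound. Two facts about critical points `a`, `b` of the distance function `d` drive the
estimate. First, every closed half-plane through `a` contains a nearest point, whence `d(b)² ≤ d(a)²
+ |a - b|²` (`distFun_sq_le`); among critical points with values at least `r`, the values therefore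
vary quadratically, `2r |d(a) - d(b)| ≤ |a - b|²`. Second, `a` has two nearest points `x`, `y` with
`|x - y| ≥ d(a)`. If `b` has nearest points close to `x` and `y`, monotonicity of the nearest-point
relation makes `b - a` almost orthogonal to `x - y`, so such critical points are parametrised by one
real coordinate on an interval of length about `r`. Cutting it into pieces of length `√(rε)` changes
the values by only `O(ε)` on each piece, so one class of critical points at scale `r` contributes
`O(√(rε))` to the measure of the `ε`-neighbourhood.

The number of classes at scale `r` is `O(V(r) / r²)`, where `V(r)` is the area of the part of a
fixed disc with `0 < d ≤ 5r`; and `V(r) → 0`, since these regions decrease to the empty set. Summing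
over `r = 2R / 4^(k+1)`, `k < m`, gives `O(√ε Σ 8^k V_k) = √ε · o(8^m)`, while smaller values lie in
an interval of length `2R / 4^m`. Taking `4^(-m)` of order `ε^(1/5)` balances both at `ε^(1/5)`; the
factor `V_k → 0` together with an arbitrarily small constant in the choice of `m` makes the content
zero.

Example. Each scale `k` has `2^k` rows of `n_k` vertical pairs of points, with squared
half-distances `ρ_k² + m / n_k²`. No point of the set enters the open disc spanned by a pair: within
a row because `m - i ≤ (m - i)²` for integers, across rows because the rows are far apart
(`pairRadius_le_norm`). Hence every half-distance is a critical value. Scale `k` yields about `k^4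
2^(4k)` values with steps about `k^(-6) 2^(-5k)`, so its gap sum of degree `4/5` is at least a
constant times `1/k`, and the series diverges. Unintended critical values inside these steps do no
harm: the set is null by the upper bound, and `t ↦ t^(4/5)` is subadditive, so subdivision cannot
decrease the gap sum. -/

/-! ### Clarke critical points and nearest points -/

section Criticality

variable {E : Type*} [NormedAddCommGroup E]

/-- Zero lies below the Clarke derivative iff difference quotients are frequently above every
negative real number. -/
theorem zero_le_clarkeDeriv_iff [NormedSpace ℝ E] {f : E → ℝ} {a v : E} :
    0 ≤ clarkeDeriv f a v ↔ ∀ c : ℝ, c < 0 →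
      ∃ᶠ p in 𝓝 a ×ˢ 𝓝[>] (0 : ℝ), c < (f (p.1 + p.2 • v) - f p.1) / p.2 := by
  unfold clarkeDeriv
  rw [le_limsup_iff]
  constructor
  · intro h c hc
    refine (h (c : EReal) (by exact_mod_cast hc)).mono ?_
    intro p hp
    exact_mod_cast hp
  · intro h y hy
    obtain ⟨c, hc1, hc2⟩ := EReal.lt_iff_exists_real_btwn.1 hy
    refine (h c (by exact_mod_cast hc2)).mono ?_
    intro p hp
    exact hc1.trans (by exact_mod_cast hp)

theorem mem_criticalPoints_iff [NormedSpace ℝ E] {f : E → ℝ} {a : E} :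
    a ∈ criticalPoints f ↔ ∀ (v : E) (c : ℝ), c < 0 →
      ∃ᶠ p in 𝓝 a ×ˢ 𝓝[>] (0 : ℝ), c < (f (p.1 + p.2 • v) - f p.1) / p.2 := by
  simp only [criticalPoints, clarkeSubdifferential, mem_ofPred_eq, zero_apply,
    EReal.coe_zero, zero_le_clarkeDeriv_iff]

theorem isClosed_criticalPoints [NormedSpace ℝ E] (f : E → ℝ) : IsClosed (criticalPoints f) := by
  rw [← isOpen_compl_iff, isOpen_iff_eventually]
  intro a ha
  simp only [mem_compl_iff, mem_criticalPoints_iff, not_forall, not_frequently] at ha ⊢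
  obtain ⟨v, c, hc, h⟩ := ha
  obtain ⟨U, hU, V, hV, hUV⟩ := mem_prod_iff.1 h
  filter_upwards [eventually_mem_nhds_iff.2 hU] with z hz
  exact ⟨v, c, hc, mem_prod_iff.2 ⟨U, hz, V, hV, hUV⟩⟩

variable [InnerProductSpace ℝ E]

open RealInnerProductSpace in
/-- At a critical point of the distance function, every closed half-plane through the point
contains a nearest point. -/
theorem exists_nearest_inner_nonneg {F : Set E} (hF : IsCompact F) (hne : F.Nonempty) {a : E}
    (ha : a ∈ criticalPoints (distFun F)) (v : E) :
    ∃ x ∈ F, distFun F a = dist a x ∧ 0 ≤ ⟪a - x, v⟫ := by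
  rw [mem_criticalPoints_iff] at ha
  have hseq : ∀ n : ℕ, ∃ p : E × ℝ, dist p.1 a < 1 / (n + 1 : ℝ) ∧ 0 < p.2 ∧
      p.2 < 1 / (n + 1 : ℝ) ∧
      -(1 / (n + 1 : ℝ)) < (distFun F (p.1 + p.2 • v) - distFun F p.1) / p.2 := by
    intro n
    have hpos : (0 : ℝ) < 1 / (n + 1 : ℝ) := by positivity
    have h1 := ha v (-(1 / (n + 1 : ℝ))) (by linarith)
    have h2 : ∀ᶠ p in 𝓝 a ×ˢ 𝓝[>] (0 : ℝ), dist p.1 a < 1 / (n + 1 : ℝ) ∧ 0 < p.2 ∧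
        p.2 < 1 / (n + 1 : ℝ) :=
      (Metric.eventually_nhds_iff.2 ⟨_, hpos, fun y hy => hy⟩ :
        ∀ᶠ y in 𝓝 a, dist y a < 1 / (n + 1 : ℝ)).prod_mk (Ioo_mem_nhdsGT hpos)
    obtain ⟨p, hp1, hp2⟩ := (h1.and_eventually h2).exists
    exact ⟨p, hp2.1, hp2.2.1, hp2.2.2, hp1⟩
  choose p hp1 hp2 hp3 hp4 using hseq
  choose x hx hxd using fun n => hF.exists_infDist_eq_dist hne (p n).1
  obtain ⟨y, hy, φ, hφ, hlim⟩ := hF.tendsto_subseq hx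
  have h0 : Tendsto (fun n : ℕ => 1 / ((φ n : ℝ) + 1)) atTop (𝓝 0) :=
    tendsto_one_div_add_atTop_nhds_zero_nat.comp hφ.tendsto_atTop
  have hz : Tendsto (fun n => (p (φ n)).1) atTop (𝓝 a) := by
    rw [tendsto_iff_dist_tendsto_zero]
    exact squeeze_zero (fun _ => dist_nonneg) (fun n => (hp1 (φ n)).le) h0
  have ht : Tendsto (fun n => (p (φ n)).2) atTop (𝓝 0) :=
    squeeze_zero (fun n => (hp2 _).le) (fun n => (hp3 (φ n)).le) h0
  refine ⟨y, hy, ?_, ?_⟩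
  · have h1 : Tendsto (fun n => distFun F (p (φ n)).1) atTop (𝓝 (distFun F a)) :=
      ((Metric.continuous_infDist_pt F).tendsto a).comp hz
    refine tendsto_nhds_unique h1 ?_
    refine (hz.dist hlim).congr fun n => ?_
    exact (hxd (φ n)).symm
  -- The point `x` nearest to `z` is also a competitor for `z + t v`, so the quotient is at most
  -- `(|z + tv - x| - |z - x|) / t`. Multiplying by the sum of the norms turns this into a
  -- polynomial inequality that passes to the limit.
  · have key : ∀ n, -(1 / ((φ n : ℝ) + 1)) * (‖(p (φ n)).1 + (p (φ n)).2 • v - x (φ n)‖ +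
        ‖(p (φ n)).1 - x (φ n)‖) ≤
        2 * ⟪(p (φ n)).1 - x (φ n), v⟫ + (p (φ n)).2 * ‖v‖ ^ 2 := by
      intro n
      set m := φ n
      set z := (p m).1
      set t := (p m).2
      have htp : 0 < t := hp2 m
      have h1 := hp4 m
      rw [lt_div_iff₀ htp] at h1
      have h2 : distFun F z = ‖z - x m‖ := by rw [← dist_eq_norm]; exact hxd m
      have h3 : distFun F (z + t • v) ≤ ‖z + t • v - x m‖ := by
        rw [← dist_eq_norm]; exact Metric.infDist_le_dist_of_mem (hx m)
      have h4 : ‖z + t • v - x m‖ ^ 2 = ‖z - x m‖ ^ 2 + 2 * (t * ⟪z - x m, v⟫) +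
          t ^ 2 * ‖v‖ ^ 2 := by
        rw [show z + t • v - x m = (z - x m) + t • v by abel, norm_add_sq_real,
          inner_smul_right, norm_smul, Real.norm_eq_abs, mul_pow, sq_abs]
      set A := ‖z + t • v - x m‖
      set B := ‖z - x m‖
      have hA : 0 ≤ A := norm_nonneg _
      have hB : 0 ≤ B := norm_nonneg _
      have h5 : -(1 / ((m : ℝ) + 1)) * t ≤ A - B := by
        have : distFun F (z + t • v) - distFun F z ≤ A - B := by linarith
        exact h1.le.trans this
      have h6 := mul_le_mul_of_nonneg_right h5 (add_nonneg hA hB)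
      refine le_of_mul_le_mul_left ?_ htp
      nlinarith
    have hL : Tendsto (fun n => -(1 / ((φ n : ℝ) + 1)) *
        (‖(p (φ n)).1 + (p (φ n)).2 • v - x (φ n)‖ + ‖(p (φ n)).1 - x (φ n)‖)) atTop
        (𝓝 (-0 * (‖a + (0 : ℝ) • v - y‖ + ‖a - y‖))) :=
      h0.neg.mul (((hz.add (ht.smul_const v)).sub hlim).norm.add (hz.sub hlim).norm)
    have hR : Tendsto (fun n => 2 * ⟪(p (φ n)).1 - x (φ n), v⟫ + (p (φ n)).2 * ‖v‖ ^ 2) atTop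
        (𝓝 (2 * ⟪a - y, v⟫ + 0 * ‖v‖ ^ 2)) :=
      (((hz.sub hlim).inner tendsto_const_nhds).const_mul 2).add (ht.mul_const _)
    have := le_of_tendsto_of_tendsto' hL hR key
    linarith

/-- The points of `F` are critical for the distance function. -/
theorem mem_criticalPoints_of_mem {F : Set E} {a : E} (ha : a ∈ F) :
    a ∈ criticalPoints (distFun F) := by
  rw [mem_criticalPoints_iff]
  intro v c hc
  have h1 : ∃ᶠ t : ℝ in 𝓝[>] 0, c < (distFun F (a + t • v) - distFun F a) / t := by
    refine Eventually.frequently ?_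
    filter_upwards [self_mem_nhdsWithin] with t ht
    have : distFun F a = 0 := Metric.infDist_zero_of_mem ha
    rw [this, sub_zero]
    exact hc.trans_le (div_nonneg Metric.infDist_nonneg (le_of_lt ht))
  have h2 : Tendsto (fun t : ℝ => (a, t)) (𝓝[>] 0) (𝓝 a ×ˢ 𝓝[>] 0) :=
    tendsto_const_nhds.prodMk tendsto_id
  exact h2.frequently h1

open RealInnerProductSpace in
/-- The midpoint of two points of `F` is critical for the distance function if `F` does not meet
the open disc having the two points as end points of a diameter. -/
theorem mem_criticalPoints_of_opposite {F : Set E} {a u : E} (h1 : a + u ∈ F)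
    (h2 : a - u ∈ F) (hd : distFun F a = ‖u‖) : a ∈ criticalPoints (distFun F) := by
  rcases eq_or_ne u 0 with rfl | hu
  · exact mem_criticalPoints_of_mem (by simpa using h1)
  have hρ : 0 < ‖u‖ := norm_pos_iff.2 hu
  rw [mem_criticalPoints_iff]
  intro v c hc
  -- The two points of the pair play symmetric roles, so `u` may be replaced by `-u`.
  wlog hv : ⟪u, v⟫ ≤ 0 generalizing u
  · refine this (u := -u) (by simpa [sub_eq_add_neg] using h2) (by simpa using h1) (by simpa using hd)
      (by simpa using hu) (by simpa using hρ) ?_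
    rw [inner_neg_left]; linarith
  -- along `z = a - s • u`, `t = θ * s` for a small fixed `θ`
  obtain ⟨θ, hθ1, hθ⟩ : ∃ θ : ℝ, θ * ‖v‖ ^ 2 < -c * ‖u‖ ∧ 0 < θ := by
    have h1 : ∀ᶠ θ : ℝ in 𝓝[>] 0, θ * ‖v‖ ^ 2 < -c * ‖u‖ := by
      have : Tendsto (fun θ : ℝ => θ * ‖v‖ ^ 2) (𝓝 0) (𝓝 (0 * ‖v‖ ^ 2)) := tendsto_id.mul_const _
      exact (this.eventually (gt_mem_nhds (by nlinarith))).filter_mono nhdsWithin_le_nhds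
    exact (h1.and self_mem_nhdsWithin).exists
  have hlim : Tendsto (fun s : ℝ => (a + s • u, θ * s)) (𝓝[>] 0) (𝓝 a ×ˢ 𝓝[>] 0) := by
    refine Tendsto.prodMk ?_ ?_
    · have : Tendsto (fun s : ℝ => a + s • u) (𝓝 0) (𝓝 (a + (0 : ℝ) • u)) :=
        tendsto_const_nhds.add (tendsto_id.smul_const u)
      simpa using this.mono_left nhdsWithin_le_nhds
    · refine tendsto_nhdsWithin_iff.2 ⟨?_, ?_⟩
      · have : Tendsto (fun s : ℝ => θ * s) (𝓝 0) (𝓝 (θ * 0)) := tendsto_id.const_mul θ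
        simpa using this.mono_left nhdsWithin_le_nhds
      · filter_upwards [self_mem_nhdsWithin] with s hs
        exact mul_pos hθ hs
  have hlt : ‖u + θ • v‖ < ‖u‖ - c * θ := by
    refine lt_of_pow_lt_pow_left₀ 2 (by nlinarith) ?_
    rw [norm_add_sq_real, inner_smul_right, norm_smul, Real.norm_eq_abs, mul_pow, sq_abs]
    nlinarith [mul_nonneg hθ.le (neg_nonneg.2 hv), mul_pos hθ (mul_pos (neg_pos.2 hc) hρ),
      mul_lt_mul_of_pos_left hθ1 hθ, sq_nonneg (c * θ)]
  refine hlim.frequently (Eventually.frequently ?_)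
  filter_upwards [Ioo_mem_nhdsGT (zero_lt_one' ℝ)] with s hs
  -- The base point `a + s u` has been moved towards `a + u`, which lowers its distance by at least
  -- `s |u|`. The 1-Lipschitz bound from `a` lets the endpoint lose at most `s |u + θ v|`, so the
  -- quotient is at least `(|u| - |u + θ v|) / θ > c`.
  have h3 : distFun F (a + s • u) ≤ (1 - s) * ‖u‖ := by
    refine (Metric.infDist_le_dist_of_mem h1).trans_eq ?_
    rw [dist_eq_norm, show a + s • u - (a + u) = (s - 1) • u by module, norm_smul,
      Real.norm_eq_abs, abs_sub_comm, abs_of_pos (by linarith [hs.2])]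
  have h4 : ‖u‖ ≤ distFun F (a + s • u + (θ * s) • v) + s * ‖u + θ • v‖ := by
    rw [← hd]
    refine (Metric.infDist_le_infDist_add_dist (y := a + s • u + (θ * s) • v)).trans_eq ?_
    rw [dist_comm, dist_eq_norm,
      show a + s • u + (θ * s) • v - a = s • (u + θ • v) by module, norm_smul, Real.norm_eq_abs,
      abs_of_pos hs.1]
    rfl
  rw [lt_div_iff₀ (mul_pos hθ hs.1)]
  nlinarith [mul_lt_mul_of_pos_left hlt hs.1]

end Criticality

/-! ### Quadratic variation of critical values and monotonicity of nearest points -/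

section Local

open RealInnerProductSpace

variable {E : Type*} [NormedAddCommGroup E] [InnerProductSpace ℝ E]

/-- The half-plane at `a` in direction `-a` contains a nearest point `x`, so `|a|² ≤ ⟪x, a⟫ ≤ R
|a|`. -/
theorem norm_le_of_mem_criticalPoints {F : Set E} (hF : IsCompact F) (hne : F.Nonempty) {R : ℝ}
    (hR : ∀ x ∈ F, ‖x‖ ≤ R) {a : E} (ha : a ∈ criticalPoints (distFun F)) : ‖a‖ ≤ R := by
  obtain ⟨x, hx, -, h⟩ := exists_nearest_inner_nonneg hF hne ha (-a)
  rw [inner_neg_right, inner_sub_left, real_inner_self_eq_norm_sq] at h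
  have h1 := real_inner_le_norm x a
  have h2 := hR x hx
  by_contra! hlt
  have : 0 < ‖a‖ := (norm_nonneg x).trans_lt (h2.trans_lt hlt)
  nlinarith

theorem isCompact_criticalPoints [ProperSpace E] {F : Set E} (hF : IsCompact F)
    (hne : F.Nonempty) : IsCompact (criticalPoints (distFun F)) := by
  obtain ⟨R, hR⟩ := hF.isBounded.exists_norm_le
  refine Metric.isCompact_of_isClosed_isBounded (isClosed_criticalPoints _) ?_
  exact isBounded_iff_forall_norm_le.2
    ⟨R, fun a ha => norm_le_of_mem_criticalPoints hF hne hR ha⟩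

theorem isCompact_criticalValues [ProperSpace E] {F : Set E} (hF : IsCompact F)
    (hne : F.Nonempty) : IsCompact (criticalValues (distFun F)) :=
  (isCompact_criticalPoints hF hne).image (Metric.continuous_infDist_pt F)

/-- A nearest point `x` of `a` in the half-plane of direction `a - b` sees `a` and `b` under a
non-obtuse angle at `a`, and `d(b) ≤ |b - x|`. Exchanging two critical points makes this a two-sided
quadratic bound. -/
theorem distFun_sq_le {F : Set E} (hF : IsCompact F) (hne : F.Nonempty) {a : E}
    (ha : a ∈ criticalPoints (distFun F)) (b : E) :
    distFun F b ^ 2 ≤ distFun F a ^ 2 + ‖a - b‖ ^ 2 := by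
  obtain ⟨x, hx, hax, h⟩ := exists_nearest_inner_nonneg hF hne ha (a - b)
  have h1 : distFun F b ≤ ‖(a - x) - (a - b)‖ := by
    rw [show a - x - (a - b) = b - x by abel, ← dist_eq_norm]
    exact Metric.infDist_le_dist_of_mem hx
  have h0 : 0 ≤ distFun F b := Metric.infDist_nonneg
  calc distFun F b ^ 2 ≤ ‖(a - x) - (a - b)‖ ^ 2 := by gcongr
    _ = ‖a - x‖ ^ 2 - 2 * ⟪a - x, a - b⟫ + ‖a - b‖ ^ 2 := norm_sub_sq_real _ _
    _ ≤ _ := by rw [hax, dist_eq_norm]; linarith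

/-- Monotonicity of the nearest-point relation: add the two minimality inequalities and cancel the
squares. -/
theorem inner_sub_nearest_nonneg {F : Set E} {a b x y : E} (hx : x ∈ F)
    (hax : distFun F a = dist a x) (hy : y ∈ F) (hby : distFun F b = dist b y) :
    0 ≤ ⟪b - a, y - x⟫ := by
  have h1 : dist b y ≤ dist b x := hby ▸ Metric.infDist_le_dist_of_mem hx
  have h2 : dist a x ≤ dist a y := hax ▸ Metric.infDist_le_dist_of_mem hy
  rw [dist_eq_norm, dist_eq_norm] at h1 h2
  have h3 : ‖b - y‖ ^ 2 ≤ ‖b - x‖ ^ 2 := by gcongr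
  have h4 : ‖a - x‖ ^ 2 ≤ ‖a - y‖ ^ 2 := by gcongr
  rw [norm_sub_sq_real, norm_sub_sq_real] at h3 h4
  rw [inner_sub_left, inner_sub_right, inner_sub_right]
  linarith

/-- A critical point has two nearest points at mutual distance at least its critical value. -/
theorem exists_nearest_pair {F : Set E} (hF : IsCompact F) (hne : F.Nonempty) {a : E}
    (ha : a ∈ criticalPoints (distFun F)) :
    ∃ x ∈ F, ∃ y ∈ F, distFun F a = dist a x ∧ distFun F a = dist a y ∧
      distFun F a ≤ ‖x - y‖ := by
  obtain ⟨x, hx, hax, -⟩ := exists_nearest_inner_nonneg hF hne ha 0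
  -- The half-plane away from `x` gives `⟪a - y, a - x⟫ ≤ 0`, hence even `|x - y|² ≥ 2 d(a)²`; the
  -- weaker bound suffices.
  obtain ⟨y, hy, hay, h⟩ := exists_nearest_inner_nonneg hF hne ha (-(a - x))
  refine ⟨x, hx, y, hy, hax, hay, ?_⟩
  have h1 : ‖x - y‖ ^ 2 = ‖a - y‖ ^ 2 - 2 * ⟪a - y, a - x⟫ + ‖a - x‖ ^ 2 := by
    rw [← norm_sub_sq_real]; congr 2; abel
  rw [inner_neg_right] at h
  rw [hax, dist_eq_norm]
  exact le_of_sq_le_sq (by nlinarith [sq_nonneg ‖a - y‖]) (norm_nonneg _)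

/-- Monotonicity is applied crosswise, to `x` with `y'` and to `y` with `x'`. Replacing `y'` by `y`
and `x'` by `x` costs `δ |b - a|` each and bounds the inner product from both sides. -/
theorem abs_inner_sub_nearest_le {F : Set E} {a b x y x' y' : E} {δ : ℝ} (hx : x ∈ F)
    (hax : distFun F a = dist a x) (hy : y ∈ F) (hay : distFun F a = dist a y)
    (hx' : x' ∈ F) (hbx : distFun F b = dist b x') (hy' : y' ∈ F) (hby : distFun F b = dist b y')
    (h1 : ‖x - x'‖ ≤ δ) (h2 : ‖y - y'‖ ≤ δ) :
    |⟪b - a, x - y⟫| ≤ δ * ‖b - a‖ := by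
  have hxy := inner_sub_nearest_nonneg hx hax hy' hby
  have hyx := inner_sub_nearest_nonneg hy hay hx' hbx
  have e1 : ⟪b - a, y' - x⟫ = ⟪b - a, y' - y⟫ - ⟪b - a, x - y⟫ := by
    rw [← inner_sub_right]; congr 1; abel
  have e2 : ⟪b - a, x' - y⟫ = ⟪b - a, x' - x⟫ + ⟪b - a, x - y⟫ := by
    rw [← inner_add_right]; congr 1; abel
  have b1 := real_inner_le_norm (b - a) (y' - y)
  have b2 := real_inner_le_norm (b - a) (x' - x)
  rw [norm_sub_rev] at h1 h2
  have c1 := mul_le_mul_of_nonneg_left h2 (norm_nonneg (b - a))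
  have c2 := mul_le_mul_of_nonneg_left h1 (norm_nonneg (b - a))
  rw [abs_le]
  constructor <;> linarith

end Local

/-! ### Almost orthogonal vectors in the plane -/

section Plane

/-- In the plane, a vector almost orthogonal to `e` is almost parallel to the rotated `e`. -/
theorem exists_norm_le_two_mul_inner {r : ℝ} (hr : 0 < r) {e : EuclideanSpace ℝ (Fin 2)}
    (he : r ≤ ‖e‖) : ∃ w : EuclideanSpace ℝ (Fin 2), ‖w‖ = 1 ∧ ∀ v : EuclideanSpace ℝ (Fin 2),
      |inner ℝ v e| ≤ 3 / 4 * r * ‖v‖ → ‖v‖ ≤ 2 * |inner ℝ w v| := by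
  have hpos : 0 < ‖e‖ := hr.trans_le he
  have hne : ‖e‖ ^ 2 = e 0 ^ 2 + e 1 ^ 2 := by
    simp [EuclideanSpace.norm_sq_eq, Fin.sum_univ_two]
  refine ⟨‖e‖⁻¹ • !₂[-e 1, e 0], ?_, fun v hv => ?_⟩
  · have h1 : ‖(!₂[-e 1, e 0] : EuclideanSpace ℝ (Fin 2))‖ = ‖e‖ := by
      rw [← sq_eq_sq₀ (norm_nonneg _) (norm_nonneg _), hne]
      simp [EuclideanSpace.norm_sq_eq, Fin.sum_univ_two, add_comm]
    rw [norm_smul, norm_inv, norm_norm, h1, inv_mul_cancel₀ hpos.ne']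
  · have hnv : ‖v‖ ^ 2 = v 0 ^ 2 + v 1 ^ 2 := by
      simp [EuclideanSpace.norm_sq_eq, Fin.sum_univ_two]
    set J : ℝ := v 0 * -e 1 + v 1 * e 0 with hJ
    have hin : inner ℝ (‖e‖⁻¹ • (!₂[-e 1, e 0] : EuclideanSpace ℝ (Fin 2))) v = ‖e‖⁻¹ * J := by
      rw [inner_smul_left]
      simp [PiLp.inner_apply, Fin.sum_univ_two, hJ]
    have hve : inner ℝ v e = v 0 * e 0 + v 1 * e 1 := by
      simp [PiLp.inner_apply, Fin.sum_univ_two]; ring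
    rw [hin, abs_mul, abs_inv, abs_norm]
    have h1 : (inner ℝ v e) ^ 2 + J ^ 2 = ‖v‖ ^ 2 * ‖e‖ ^ 2 := by
      rw [hve, hJ, hne, hnv]; ring
    have h2 : (inner ℝ v e) ^ 2 ≤ (3 / 4 * r * ‖v‖) ^ 2 := by
      rw [← sq_abs]; gcongr
    have h3 : (3 / 4 * r * ‖v‖) ^ 2 ≤ 9 / 16 * (‖v‖ ^ 2 * ‖e‖ ^ 2) := by
      have : r ^ 2 ≤ ‖e‖ ^ 2 := by gcongr
      nlinarith [mul_le_mul_of_nonneg_right this (sq_nonneg ‖v‖)]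
    -- The squared cosine is at most `9/16`, so the squared sine is at least `7/16`, more than the
    -- `1/4` needed.
    have h4 : ‖v‖ * ‖e‖ ≤ 2 * |J| := by
      refine le_of_sq_le_sq ?_ (by positivity)
      rw [mul_pow, mul_pow, sq_abs]
      nlinarith [mul_nonneg (sq_nonneg ‖v‖) (sq_nonneg ‖e‖)]
    rw [← mul_le_mul_iff_left₀ hpos]
    calc ‖v‖ * ‖e‖ ≤ 2 * |J| := h4
      _ = 2 * (‖e‖⁻¹ * |J|) * ‖e‖ := by field_simp

end Plane

/-! ### Neighbourhoods of images under quadratically varying functions -/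

section Thickening

theorem volume_thickening_le_of_abs_sub_le {A : Set ℝ} {ε : ℝ}
    (h : ∀ x ∈ A, ∀ y ∈ A, |x - y| ≤ 2 * ε) :
    volume (Metric.thickening (2 * ε) A) ≤ ENNReal.ofReal (8 * ε) := by
  rcases A.eq_empty_or_nonempty with rfl | ⟨y, hy⟩
  · simp
  have : Metric.thickening (2 * ε) A ⊆ Metric.closedBall y (4 * ε) := by
    intro z hz
    obtain ⟨x, hx, hzx⟩ := Metric.mem_thickening_iff.1 hz
    have h1 := dist_triangle z x y
    have h2 := h x hx y hy
    rw [← Real.dist_eq] at h2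
    rw [Metric.mem_closedBall]
    linarith
  refine (measure_mono this).trans_eq ?_
  rw [Real.volume_closedBall]
  congr 1
  ring

theorem volume_thickening_iUnion_le {ι : Type*} [Fintype ι] (δ : ℝ) (A : ι → Set ℝ) {V : ℝ≥0∞}
    (h : ∀ i, volume (Metric.thickening δ (A i)) ≤ V) :
    volume (Metric.thickening δ (⋃ i, A i)) ≤ Fintype.card ι * V := by
  rw [Metric.thickening_iUnion]
  refine (measure_iUnion_fintype_le _ _).trans ?_
  refine (Finset.sum_le_sum fun i _ => h i).trans_eq ?_
  simp

/-- The values of a function that varies at most quadratically in a bounded real parameter form a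
set with few `ε`-separated points. -/
theorem volume_thickening_image_le {α : Type*} {S : Set α} {f g : α → ℝ} {r ε : ℝ} (hε : 0 < ε)
    (hεr : ε ≤ r) (hg : ∀ a ∈ S, ∀ b ∈ S, |g a - g b| ≤ r)
    (hfg : ∀ a ∈ S, ∀ b ∈ S, r * |f a - f b| ≤ 2 * (g a - g b) ^ 2) :
    volume (Metric.thickening (2 * ε) (f '' S)) ≤ ENNReal.ofReal (24 * √(r * ε)) := by
  rcases S.eq_empty_or_nonempty with rfl | ⟨a₀, ha₀⟩
  · simp
  have hr : 0 < r := hε.trans_le hεr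
  -- Cell length chosen so that the variation of `f` on a cell is at most `2 δ² / r = 2ε`.
  set δ := √(r * ε) with hδ
  have hδ0 : 0 < δ := Real.sqrt_pos.2 (mul_pos hr hε)
  have hδ2 : δ ^ 2 = r * ε := Real.sq_sqrt (mul_pos hr hε).le
  have hδr : δ ≤ r := by
    refine le_of_sq_le_sq ?_ hr.le
    nlinarith
  -- With this origin, `g - c` takes values in `[0, 2r]`, so natural-number floors index the cells.
  set c := g a₀ - r
  have hc : ∀ a ∈ S, 0 ≤ (g a - c) / δ ∧ (g a - c) / δ ≤ 2 * r / δ := by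
    intro a ha
    have := abs_le.1 (hg a ha a₀ ha₀)
    constructor
    · exact div_nonneg (by simp only [c]; linarith) hδ0.le
    · gcongr
      simp only [c]; linarith
  set N := ⌊2 * r / δ⌋₊ + 1
  have hcov : f '' S ⊆ ⋃ i : Fin N, f '' {a ∈ S | ⌊(g a - c) / δ⌋₊ = i} := by
    rintro _ ⟨a, ha, rfl⟩
    have : ⌊(g a - c) / δ⌋₊ < N := Nat.lt_succ_of_le (Nat.floor_le_floor (hc a ha).2)
    exact mem_iUnion.2 ⟨⟨_, this⟩, a, ⟨ha, rfl⟩, rfl⟩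
  refine (measure_mono (Metric.thickening_subset_of_subset _ hcov)).trans ?_
  refine (volume_thickening_iUnion_le (V := ENNReal.ofReal (8 * ε)) _ _ fun i => ?_).trans ?_
  · refine volume_thickening_le_of_abs_sub_le ?_
    rintro _ ⟨a, ⟨ha, hai⟩, rfl⟩ _ ⟨b, ⟨hb, hbi⟩, rfl⟩
    have h1 : |g a - g b| ≤ δ := by
      have ea := Nat.floor_le (hc a ha).1
      have eb := Nat.floor_le (hc b hb).1
      have la := Nat.lt_floor_add_one ((g a - c) / δ)
      have lb := Nat.lt_floor_add_one ((g b - c) / δ)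
      rw [hai] at ea la
      rw [hbi] at eb lb
      rw [le_div_iff₀ hδ0] at ea eb
      rw [div_lt_iff₀ hδ0] at la lb
      rw [abs_le]
      constructor <;> linarith
    have h2 : (g a - g b) ^ 2 ≤ δ ^ 2 := by rw [← sq_abs]; gcongr
    have h3 := hfg a ha b hb
    refine le_of_mul_le_mul_left ?_ hr
    linarith
  · rw [Fintype.card_fin, ← ENNReal.ofReal_natCast, ← ENNReal.ofReal_mul (by positivity)]
    refine ENNReal.ofReal_le_ofReal ?_
    -- The extra cell is absorbed by `1 ≤ r / δ`, which is where `ε ≤ r` enters.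
    have h1 : (N : ℝ) ≤ 3 * r / δ := by
      have : (N : ℝ) ≤ 2 * r / δ + 1 := by
        simp only [N, Nat.cast_add, Nat.cast_one]
        gcongr
        exact Nat.floor_le (by positivity)
      refine this.trans ?_
      rw [div_add_one hδ0.ne']
      gcongr
      linarith
    calc (N : ℝ) * (8 * ε) ≤ 3 * r / δ * (8 * ε) := by gcongr
      _ = 24 * (r * ε) / δ := by ring
      _ = 24 * δ := by rw [← hδ2]; field_simp

end Thickening

/-! ### Finite nets controlled by volume -/

section Packing

variable {E : Type*} [NormedAddCommGroup E] [NormedSpace ℝ E] [FiniteDimensional ℝ E]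
  [MeasurableSpace E] [BorelSpace E]

/-- A set whose `ρ/2`-neighbourhood has finite measure has a finite `ρ`-net whose cardinality is
controlled by that measure. -/
theorem exists_finset_net (μ : Measure E) [μ.IsAddHaarMeasure] {S Ω : Set E} {ρ : ℝ} (hρ : 0 < ρ)
    (hS : Bornology.IsBounded S) (hΩ : ∀ a ∈ S, Metric.ball a (ρ / 2) ⊆ Ω) :
    ∃ T : Finset E, ↑T ⊆ S ∧ (∀ a ∈ S, ∃ t ∈ T, dist a t ≤ ρ) ∧
      T.card * μ (Metric.ball 0 (ρ / 2)) ≤ μ Ω := by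
  have := FiniteDimensional.proper_real E
  lift ρ to ℝ≥0 using hρ.le
  have hfin : Metric.packingNumber ρ S ≠ ⊤ := by
    have hρ2 : ρ / 2 ≠ 0 := by
      have : (ρ : ℝ) ≠ 0 := hρ.ne'
      simpa using this
    obtain ⟨N, -, hN, hcov⟩ := Metric.exists_finite_isCover_of_isCompact_closure hρ2
      hS.isCompact_closure
    have h1 := Metric.packingNumber_two_mul_le_externalCoveringNumber (ρ / 2) S
    rw [mul_div_cancel₀ ρ two_ne_zero] at h1
    exact ((h1.trans hcov.externalCoveringNumber_le_encard).trans_lt hN.encard_lt_top).ne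
  set T := Metric.maximalSeparatedSet ρ S
  have hTfin : T.Finite := by
    rw [← Set.encard_ne_top_iff, Metric.encard_maximalSeparatedSet hfin]
    exact hfin
  have hTS : T ⊆ S := Metric.maximalSeparatedSet_subset
  refine ⟨hTfin.toFinset, by simpa using hTS, fun a ha => ?_, ?_⟩
  · obtain ⟨t, ht, hat⟩ := Metric.isCover_maximalSeparatedSet hfin ha
    refine ⟨t, by simpa using ht, ?_⟩
    have : edist a t ≤ ρ := hat
    rwa [edist_dist, ENNReal.ofReal_le_coe] at this
  · have hdisj : (hTfin.toFinset : Set E).PairwiseDisjoint fun t => Metric.ball t (ρ / 2 : ℝ) := by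
      intro s hs t ht hst
      rw [Finset.mem_coe, Set.Finite.mem_toFinset] at hs ht
      refine Metric.ball_disjoint_ball ?_
      have : (ρ : ℝ≥0∞) < edist s t := Metric.isSeparated_maximalSeparatedSet hs ht hst
      rw [edist_nndist, ENNReal.coe_lt_coe, ← NNReal.coe_lt_coe, coe_nndist] at this
      linarith
    calc hTfin.toFinset.card * μ (Metric.ball 0 (ρ / 2 : ℝ))
        = ∑ t ∈ hTfin.toFinset, μ (Metric.ball t (ρ / 2 : ℝ)) := by
          simp [Measure.addHaar_ball_center]
      _ = μ (⋃ t ∈ hTfin.toFinset, Metric.ball t (ρ / 2 : ℝ)) :=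
          (measure_biUnion_finset hdisj fun t _ => measurableSet_ball).symm
      _ ≤ μ Ω := measure_mono <| iUnion₂_subset fun t ht => hΩ t (hTS (by simpa using ht))

end Packing

/-! ### Critical values of a single scale -/

section Scale

/-- The set of points of a disc with distance in `(0, 5 r]` from `F`. -/
def annularRegion {E : Type*} [NormedAddCommGroup E] (F : Set E) (R r : ℝ) : Set E :=
  {x | ‖x‖ ≤ 2 * R ∧ 0 < distFun F x ∧ distFun F x ≤ 5 * r}

theorem card_le_of_card_mul_volume_ball_le {n : ℕ} {r : ℝ} (hr : 0 < r) {V : ℝ≥0∞}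
    (h : n * volume (Metric.ball (0 : EuclideanSpace ℝ (Fin 2)) r) ≤ V) :
    (n : ℝ≥0∞) ≤ ENNReal.ofReal (1 / r ^ 2) * V := by
  rw [EuclideanSpace.volume_ball_fin_two, ← ENNReal.ofReal_pow hr.le] at h
  have h1 : (n : ℝ≥0∞) * ENNReal.ofReal (r ^ 2) ≤ V := by
    refine le_trans ?_ h
    rw [← mul_assoc]
    refine le_mul_of_one_le_right zero_le ?_
    rw [ENNReal.one_le_ofReal]
    linarith [Real.pi_gt_three]
  calc (n : ℝ≥0∞) = ENNReal.ofReal (1 / r ^ 2) * (n * ENNReal.ofReal (r ^ 2)) := by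
        rw [mul_left_comm, ← ENNReal.ofReal_mul (by positivity), one_div_mul_cancel (by positivity),
          ENNReal.ofReal_one, mul_one]
    _ ≤ _ := by gcongr

/-- The bound `160²` is the area ratio of discs of radii `5r` and `r/32`. It does not depend on `r`,
so sorting displacement vectors by this net costs only a constant factor. -/
theorem exists_finset_net_closedBall {r : ℝ} (hr : 0 < r) :
    ∃ T : Finset (EuclideanSpace ℝ (Fin 2)),
      (∀ a, ‖a‖ ≤ 4 * r → ∃ t ∈ T, dist a t ≤ r / 16) ∧ T.card ≤ 160 ^ 2 := by
  obtain ⟨T, -, hT, hcard⟩ := exists_finset_net (volume : Measure (EuclideanSpace ℝ (Fin 2)))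
    (S := Metric.closedBall 0 (4 * r)) (Ω := Metric.ball 0 (5 * r)) (ρ := r / 16)
    (by positivity) Metric.isBounded_closedBall fun a ha => by
      refine Metric.ball_subset_ball' ?_
      have := Metric.mem_closedBall.1 ha
      linarith
  refine ⟨T, fun a ha => hT a (by simpa using ha), ?_⟩
  have h5 : volume (Metric.ball (0 : EuclideanSpace ℝ (Fin 2)) (5 * r)) =
      ENNReal.ofReal (160 ^ 2) * volume (Metric.ball (0 : EuclideanSpace ℝ (Fin 2)) (r / 16 / 2)) := by
    have h2 : 5 * r = 160 * (r / 16 / 2) := by ring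
    rw [h2, Measure.addHaar_ball_mul _ _ (by norm_num)]
    simp
  rw [h5] at hcard
  have h0 : volume (Metric.ball (0 : EuclideanSpace ℝ (Fin 2)) (r / 16 / 2)) ≠ 0 :=
    (Metric.measure_ball_pos _ _ (by positivity)).ne'
  rw [ENNReal.mul_le_mul_iff_left h0 measure_ball_lt_top.ne] at hcard
  rw [← ENNReal.ofReal_natCast, ENNReal.ofReal_le_ofReal_iff (by positivity)] at hcard
  exact_mod_cast hcard

variable {F : Set (EuclideanSpace ℝ (Fin 2))}

/-- The key local estimate: critical values at critical points that are close to each other and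
have nearest points close to each other. -/
theorem volume_thickening_distFun_image_le (hF : IsCompact F) (hne : F.Nonempty) {r ε : ℝ}
    (hε : 0 < ε) (hεr : ε ≤ r) {S : Set (EuclideanSpace ℝ (Fin 2))}
    {X Y : EuclideanSpace ℝ (Fin 2) → EuclideanSpace ℝ (Fin 2)}
    (hcrit : S ⊆ criticalPoints (distFun F)) (hd : ∀ a ∈ S, r ≤ distFun F a)
    (hX : ∀ a ∈ S, X a ∈ F ∧ distFun F a = dist a (X a))
    (hY : ∀ a ∈ S, Y a ∈ F ∧ distFun F a = dist a (Y a))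
    (hXY : ∀ a ∈ S, r ≤ ‖X a - Y a‖) (hS : ∀ a ∈ S, ∀ b ∈ S, ‖a - b‖ ≤ r)
    (hXX : ∀ a ∈ S, ∀ b ∈ S, ‖X a - X b‖ ≤ r / 4)
    (hYY : ∀ a ∈ S, ∀ b ∈ S, ‖Y a - Y b‖ ≤ r / 4) :
    volume (Metric.thickening (2 * ε) (distFun F '' S)) ≤ ENNReal.ofReal (24 * √(r * ε)) := by
  have hr : 0 < r := hε.trans_le hεr
  rcases S.eq_empty_or_nonempty with rfl | ⟨c, hc⟩
  · simp
  obtain ⟨w, hw, hwv⟩ := exists_norm_le_two_mul_inner hr (hXY c hc)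
  refine volume_thickening_image_le (g := fun a => inner ℝ w a) hε hεr ?_ ?_
  · intro a ha b hb
    rw [← inner_sub_right]
    refine (abs_real_inner_le_norm _ _).trans ?_
    rw [hw, one_mul]
    exact hS a ha b hb
  · intro a ha b hb
    -- The direction `w` comes from one reference pair `X c - Y c`. The `3/4` is `1/4` from
    -- monotonicity plus `1/2` for replacing the pair of `a` by that of `c`.
    have h1 : ‖b - a‖ ≤ 2 * |inner ℝ w (b - a)| := by
      refine hwv _ ?_
      have h2 := abs_inner_sub_nearest_le (hX a ha).1 (hX a ha).2 (hY a ha).1 (hY a ha).2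
        (hX b hb).1 (hX b hb).2 (hY b hb).1 (hY b hb).2 (hXX a ha b hb) (hYY a ha b hb)
      have h3 : ‖(X c - Y c) - (X a - Y a)‖ ≤ r / 2 := by
        rw [show (X c - Y c) - (X a - Y a) = (X c - X a) - (Y c - Y a) by abel]
        refine (norm_sub_le _ _).trans ?_
        linarith [hXX c hc a ha, hYY c hc a ha]
      have h4 := abs_real_inner_le_norm (b - a) ((X c - Y c) - (X a - Y a))
      rw [← sub_add_cancel (X c - Y c) (X a - Y a), inner_add_right]
      refine (abs_add_le _ _).trans ?_
      nlinarith [mul_le_mul_of_nonneg_left h3 (norm_nonneg (b - a))]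
    have ea := distFun_sq_le hF hne (hcrit ha) b
    have eb := distFun_sq_le hF hne (hcrit hb) a
    rw [norm_sub_rev] at ea
    -- Combined with `d(a) + d(b) ≥ 2r`, this turns the quadratic bound on squared values into `r
    -- |d(a) - d(b)| ≤ 2 (g a - g b)²`.
    have h5 : ‖b - a‖ ^ 2 ≤ 4 * (inner ℝ w a - inner ℝ w b) ^ 2 := by
      calc ‖b - a‖ ^ 2 ≤ (2 * |inner ℝ w (b - a)|) ^ 2 := by gcongr
        _ = _ := by rw [mul_pow, sq_abs, inner_sub_right]; ring
    have ha' := hd a ha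
    have hb' := hd b hb
    rcases le_total (distFun F a) (distFun F b) with hab | hab
    · rw [abs_of_nonpos (by linarith)]
      nlinarith
    · rw [abs_of_nonneg (by linarith)]
      nlinarith

/-- Classes are indexed by a net point near `a` and two net points near the displacements to its
nearest points. The discs of radius `r/32` about critical points of this scale lie in the annular
region, so only the first index depends on `F`, and it is counted by area. -/
theorem volume_thickening_criticalValues_scale_le (hF : IsCompact F) (hne : F.Nonempty) {R : ℝ}
    (hR : ∀ x ∈ F, ‖x‖ ≤ R) {r ε : ℝ} (hε : 0 < ε) (hεr : ε ≤ r) (hrR : r ≤ R) :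
    volume (Metric.thickening (2 * ε)
      (distFun F '' {a ∈ criticalPoints (distFun F) | r ≤ distFun F a ∧ distFun F a ≤ 4 * r})) ≤
      ENNReal.ofReal (24 * 32 ^ 2 * 160 ^ 4 * (√(r * ε) / r ^ 2)) *
        volume (annularRegion F R r) := by
  have hr : 0 < r := hε.trans_le hεr
  set S := {a ∈ criticalPoints (distFun F) | r ≤ distFun F a ∧ distFun F a ≤ 4 * r}
  obtain ⟨T, -, hT, hcard⟩ := exists_finset_net (volume : Measure (EuclideanSpace ℝ (Fin 2)))
    (S := S) (Ω := annularRegion F R r) (ρ := r / 16) (by positivity)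
    ((isCompact_criticalPoints hF hne).isBounded.subset fun a ha => ha.1) (by
      intro a ha x hx
      rw [Metric.mem_ball, dist_eq_norm] at hx
      have h1 := norm_le_of_mem_criticalPoints hF hne hR ha.1
      have h2 : ‖x‖ ≤ ‖a‖ + ‖x - a‖ := by simpa using norm_add_le a (x - a)
      have h3 : distFun F a ≤ distFun F x + dist a x := Metric.infDist_le_infDist_add_dist
      have h4 : distFun F x ≤ distFun F a + dist x a := Metric.infDist_le_infDist_add_dist
      rw [dist_eq_norm] at h3 h4
      rw [norm_sub_rev] at h3
      obtain ⟨-, h5, h6⟩ := ha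
      exact ⟨by linarith, by linarith, by linarith⟩)
  obtain ⟨T₀, hT₀, hcard₀⟩ := exists_finset_net_closedBall hr
  have hcard' := card_le_of_card_mul_volume_ball_le (by positivity) hcard
  have hch : ∀ a ∈ S, ∃ x y, x ∈ F ∧ y ∈ F ∧ distFun F a = dist a x ∧ distFun F a = dist a y ∧
      distFun F a ≤ ‖x - y‖ := by
    intro a ha
    obtain ⟨x, hx, y, hy, h⟩ := exists_nearest_pair hF hne ha.1
    exact ⟨x, y, hx, hy, h⟩
  choose! X Y hX hY hXd hYd hXY using hch
  have hcov : distFun F '' S ⊆ ⋃ i : T × T₀ × T₀, distFun F '' {a ∈ S | dist a i.1 ≤ r / 16 ∧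
      dist (X a - a) i.2.1 ≤ r / 16 ∧ dist (Y a - a) i.2.2 ≤ r / 16} := by
    rintro _ ⟨a, ha, rfl⟩
    obtain ⟨t, ht, hat⟩ := hT a ha
    obtain ⟨s, hs, has⟩ := hT₀ (X a - a) (by
      rw [norm_sub_rev, ← dist_eq_norm, ← hXd a ha]; exact ha.2.2)
    obtain ⟨u, hu, hau⟩ := hT₀ (Y a - a) (by
      rw [norm_sub_rev, ← dist_eq_norm, ← hYd a ha]; exact ha.2.2)
    exact mem_iUnion.2 ⟨(⟨t, ht⟩, ⟨s, hs⟩, ⟨u, hu⟩), a, ⟨ha, hat, has, hau⟩, rfl⟩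
  refine (measure_mono (Metric.thickening_subset_of_subset _ hcov)).trans ?_
  refine (volume_thickening_iUnion_le (V := ENNReal.ofReal (24 * √(r * ε))) _ _ ?_).trans ?_
  · rintro ⟨t, s, u⟩
    have hdiff : ∀ {Z : EuclideanSpace ℝ (Fin 2) → EuclideanSpace ℝ (Fin 2)}
        {a b c : EuclideanSpace ℝ (Fin 2)}, dist a t ≤ r / 16 → dist b t ≤ r / 16 →
        dist (Z a - a) c ≤ r / 16 → dist (Z b - b) c ≤ r / 16 → ‖Z a - Z b‖ ≤ r / 4 := by
      intro Z a b c h1 h2 h3 h4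
      have h5 := dist_triangle_right a b (t : EuclideanSpace ℝ (Fin 2))
      have h6 := dist_triangle_right (Z a - a) (Z b - b) c
      rw [dist_eq_norm a b] at h5
      rw [dist_eq_norm (Z a - a) (Z b - b)] at h6
      have h7 := norm_add_le (a - b) ((Z a - a) - (Z b - b))
      rw [show (a - b) + ((Z a - a) - (Z b - b)) = Z a - Z b by abel] at h7
      linarith
    refine volume_thickening_distFun_image_le hF hne hε hεr (X := X) (Y := Y)
      (fun a ha => ha.1.1) (fun a ha => ha.1.2.1) (fun a ha => ⟨hX a ha.1, hXd a ha.1⟩)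
      (fun a ha => ⟨hY a ha.1, hYd a ha.1⟩) (fun a ha => ha.1.2.1.trans (hXY a ha.1)) ?_ ?_ ?_
    · intro a ha b hb
      have h5 := dist_triangle_right a b (t : EuclideanSpace ℝ (Fin 2))
      rw [dist_eq_norm a b] at h5
      linarith [ha.2.1, hb.2.1]
    · intro a ha b hb
      exact hdiff ha.2.1 hb.2.1 ha.2.2.1 hb.2.2.1
    · intro a ha b hb
      exact hdiff ha.2.1 hb.2.1 ha.2.2.2 hb.2.2.2
  · have h0 : (T₀.card : ℝ≥0∞) ≤ ENNReal.ofReal (160 ^ 2) := by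
      rw [← ENNReal.ofReal_natCast]
      exact ENNReal.ofReal_le_ofReal (by exact_mod_cast hcard₀)
    simp only [Fintype.card_prod, Fintype.card_coe, Nat.cast_mul]
    calc (T.card : ℝ≥0∞) * (T₀.card * T₀.card) * ENNReal.ofReal (24 * √(r * ε))
        ≤ (ENNReal.ofReal (1 / (r / 16 / 2) ^ 2) * volume (annularRegion F R r)) *
          (ENNReal.ofReal (160 ^ 2) * ENNReal.ofReal (160 ^ 2)) *
          ENNReal.ofReal (24 * √(r * ε)) := by gcongr
      _ = ENNReal.ofReal (1 / (r / 16 / 2) ^ 2) * (ENNReal.ofReal (160 ^ 2) *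
          ENNReal.ofReal (160 ^ 2)) * ENNReal.ofReal (24 * √(r * ε)) *
          volume (annularRegion F R r) := by ring
      _ = _ := by
        rw [← ENNReal.ofReal_mul (by positivity), ← ENNReal.ofReal_mul (by positivity),
          ← ENNReal.ofReal_mul (by positivity)]
        congr 2
        field_simp
        ring

end Scale

/-! ### Summation over scales and vanishing of the Minkowski content -/

section Content

/-- Partial sums of `o(8^k)` are `o` of the partial sums of the divergent series `Σ 8^k`, which are
`O(8^m)`. -/
theorem tendsto_sum_pow_mul_div_pow {V : ℕ → ℝ} (hV : Tendsto V atTop (𝓝 0)) :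
    Tendsto (fun m => (∑ k ∈ Finset.range m, 8 ^ k * V k) / 8 ^ m) atTop (𝓝 0) := by
  have h1 : (fun k => (8 : ℝ) ^ k * V k) =o[atTop] fun k => (8 : ℝ) ^ k := by
    refine (Asymptotics.isLittleO_iff_tendsto' ?_).2 ?_
    · exact Eventually.of_forall fun k hk => absurd hk (by positivity)
    · refine hV.congr fun k => ?_
      field_simp
  have hge : ∀ m, ∑ k ∈ Finset.range m, (8 : ℝ) ^ k = (8 ^ m - 1) / 7 := by
    intro m
    rw [geom_sum_eq (by norm_num)]
    norm_num
  have hpow : Tendsto (fun m : ℕ => (8 : ℝ) ^ m) atTop atTop :=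
    tendsto_pow_atTop_atTop_of_one_lt (by norm_num)
  have h2 := h1.sum_range (fun k => by positivity) (by
    simp only [hge]
    exact (tendsto_atTop_add_const_right _ _ hpow).atTop_div_const (by norm_num))
  have h3 : (fun m : ℕ => ∑ k ∈ Finset.range m, (8 : ℝ) ^ k) =O[atTop] fun m => (8 : ℝ) ^ m := by
    refine Asymptotics.IsBigO.of_bound 1 (Eventually.of_forall fun m => ?_)
    have : (1 : ℝ) ≤ 8 ^ m := one_le_pow₀ (by norm_num)
    rw [hge, Real.norm_of_nonneg (by linarith), Real.norm_of_nonneg (by positivity)]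
    linarith
  exact (h2.trans_isBigO h3).tendsto_div_nhds_zero

variable {F : Set (EuclideanSpace ℝ (Fin 2))}

theorem volume_annularRegion_lt_top (R r : ℝ) : volume (annularRegion F R r) < ⊤ := by
  refine (measure_mono (t := Metric.closedBall 0 (2 * R)) ?_).trans_lt measure_closedBall_lt_top
  intro x hx
  simpa using hx.1

/-- Continuity of the measure from above. Excluding distance zero is essential: it makes the
intersection empty even when `F` has positive area. -/
theorem tendsto_volume_annularRegion (R : ℝ) {r : ℕ → ℝ} (hr : Antitone r)
    (hr0 : Tendsto r atTop (𝓝 0)) :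
    Tendsto (fun k => volume (annularRegion F R (r k))) atTop (𝓝 0) := by
  have hcont : Continuous (distFun F) := Metric.continuous_infDist_pt F
  have hmeas : ∀ k, MeasurableSet (annularRegion F R (r k)) := fun k =>
    (isClosed_le continuous_norm continuous_const).measurableSet.inter
      ((isOpen_lt continuous_const hcont).measurableSet.inter
        (isClosed_le hcont continuous_const).measurableSet)
  have h := tendsto_measure_iInter_atTop (μ := volume)
    (fun k => (hmeas k).nullMeasurableSet) (fun i j hij x hx =>
      ⟨hx.1, hx.2.1, hx.2.2.trans (by linarith [hr hij])⟩)
    ⟨0, (volume_annularRegion_lt_top (F := F) R (r 0)).ne⟩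
  rwa [eq_empty_of_forall_notMem (s := ⋂ k, annularRegion F R (r k)), measure_empty] at h
  intro x hx
  rw [mem_iInter] at hx
  refine (hx 0).2.1.not_ge ?_
  refine ge_of_tendsto' (x := atTop) (f := fun k => 5 * r k) ?_ fun k => (hx k).2.2
  simpa using hr0.const_mul 5

/-- With `r = (R/2) / 4^k`, the factor `√(rε) / r²` of one scale equals a constant times `√ε · 8^k`.
Values below the cutoff `2R / 4^m` are only covered by an interval. -/
theorem volume_thickening_criticalValues_le (hF : IsCompact F) (hne : F.Nonempty) {R : ℝ}
    (hR0 : 0 < R) (hR : ∀ x ∈ F, ‖x‖ ≤ R) :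
    ∃ C : ℝ, 0 < C ∧ ∀ (m : ℕ) (ε : ℝ), 0 < ε → ε ≤ 2 * R / 4 ^ m →
      volume (Metric.thickening (2 * ε) (criticalValues (distFun F))) ≤
        ENNReal.ofReal (2 * R / 4 ^ m + 4 * ε + C * √ε * ∑ k ∈ Finset.range m,
          8 ^ k * (volume (annularRegion F R (2 * R / 4 ^ (k + 1)))).toReal) := by
  refine ⟨24 * 32 ^ 2 * 160 ^ 4 * (√(R / 2) / (R / 2) ^ 2), by positivity, fun m ε hε hεm => ?_⟩
  have hcov : criticalValues (distFun F) ⊆ Icc 0 (2 * R / 4 ^ m) ∪ ⋃ k ∈ Finset.range m,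
      distFun F '' {a ∈ criticalPoints (distFun F) | 2 * R / 4 ^ (k + 1) ≤ distFun F a ∧
        distFun F a ≤ 4 * (2 * R / 4 ^ (k + 1))} := by
    rintro _ ⟨a, ha, rfl⟩
    have h0 : 0 ≤ distFun F a := Metric.infDist_nonneg
    have h1 : distFun F a ≤ 2 * R / 4 ^ 0 := by
      obtain ⟨x, hx, hax, -⟩ := exists_nearest_inner_nonneg hF hne ha 0
      rw [hax, dist_eq_norm]
      have := norm_sub_le a x
      have := norm_le_of_mem_criticalPoints hF hne hR ha
      have := hR x hx
      norm_num
      linarith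
    clear hεm
    induction m with
    | zero => exact Or.inl ⟨h0, h1⟩
    | succ m ih =>
      rcases ih with ih | ih
      · rcases le_total (distFun F a) (2 * R / 4 ^ (m + 1)) with h | h
        · exact Or.inl ⟨h0, h⟩
        · refine Or.inr (mem_biUnion (Finset.mem_coe.2 (Finset.self_mem_range_succ m)) ?_)
          refine ⟨a, ⟨ha, h, ih.2.trans_eq ?_⟩, rfl⟩
          rw [pow_succ]
          field_simp
      · refine Or.inr ?_
        rw [mem_iUnion₂] at ih ⊢
        obtain ⟨k, hk, hka⟩ := ih
        exact ⟨k, Finset.mem_range_succ_iff.2 (Finset.mem_range.1 hk).le, hka⟩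
  have hfirst : volume (Metric.thickening (2 * ε) (Icc 0 (2 * R / 4 ^ m))) ≤
      ENNReal.ofReal (2 * R / 4 ^ m + 4 * ε) := by
    have hsub : Metric.thickening (2 * ε) (Icc 0 (2 * R / 4 ^ m)) ⊆
        Icc (-(2 * ε)) (2 * R / 4 ^ m + 2 * ε) := by
      intro x hx
      obtain ⟨y, hy, hxy⟩ := Metric.mem_thickening_iff.1 hx
      rw [Real.dist_eq, abs_lt] at hxy
      exact ⟨by linarith [hy.1], by linarith [hy.2]⟩
    refine (measure_mono hsub).trans_eq ?_
    rw [Real.volume_Icc]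
    congr 1
    ring
  have hterm : ∀ k ∈ Finset.range m, volume (Metric.thickening (2 * ε)
      (distFun F '' {a ∈ criticalPoints (distFun F) | 2 * R / 4 ^ (k + 1) ≤ distFun F a ∧
        distFun F a ≤ 4 * (2 * R / 4 ^ (k + 1))})) ≤
      ENNReal.ofReal (24 * 32 ^ 2 * 160 ^ 4 * (√(R / 2) / (R / 2) ^ 2) * √ε *
        (8 ^ k * (volume (annularRegion F R (2 * R / 4 ^ (k + 1)))).toReal)) := by
    intro k hk
    have h4 : (1 : ℝ) ≤ 4 ^ k := one_le_pow₀ (by norm_num)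
    refine (volume_thickening_criticalValues_scale_le hF hne hR hε ?_ ?_).trans_eq ?_
    · refine hεm.trans ?_
      gcongr
      · norm_num
      · exact Finset.mem_range.1 hk
    · rw [div_le_iff₀ (by positivity), pow_succ]
      nlinarith
    · rw [← ENNReal.ofReal_toReal (volume_annularRegion_lt_top (F := F) R _).ne,
        ← ENNReal.ofReal_mul (by positivity), ENNReal.toReal_ofReal ENNReal.toReal_nonneg]
      congr 1
      have e1 : 2 * R / 4 ^ (k + 1) = R / 2 / (2 ^ k) ^ 2 := by
        rw [← pow_mul, mul_comm k, pow_mul, pow_succ]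
        norm_num
        field_simp
        norm_num
      have e2 : √(2 * R / 4 ^ (k + 1) * ε) = √(R / 2) / 2 ^ k * √ε := by
        rw [Real.sqrt_mul (by positivity), e1, Real.sqrt_div (by positivity),
          Real.sqrt_sq (by positivity)]
      have e3 : (8 : ℝ) ^ k = (2 ^ k) ^ 3 := by
        rw [← pow_mul, mul_comm k, pow_mul]; norm_num
      rw [e2, e3]
      nth_rewrite 1 [e1]
      field_simp
  refine (measure_mono (Metric.thickening_subset_of_subset _ hcov)).trans ?_
  simp only [Metric.thickening_union, Metric.thickening_iUnion]
  refine (measure_union_le _ _).trans ?_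
  rw [ENNReal.ofReal_add (by positivity) (by positivity), Finset.mul_sum,
    ENNReal.ofReal_sum_of_nonneg fun k _ => by positivity]
  exact add_le_add hfirst ((measure_biUnion_finset_le _ _).trans (Finset.sum_le_sum hterm))

theorem upperMinkowskiContent_criticalValues (hF : IsCompact F) (hne : F.Nonempty) :
    upperMinkowskiContent (4 / 5) (criticalValues (distFun F)) = 0 := by
  obtain ⟨R, hR0, hR⟩ := hF.isBounded.exists_pos_norm_le
  obtain ⟨C, hC, hmain⟩ := volume_thickening_criticalValues_le hF hne hR0 hR
  set V : ℕ → ℝ := fun k => (volume (annularRegion F R (2 * R / 4 ^ (k + 1)))).toReal with hVdef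
  have hr0 : Tendsto (fun k : ℕ => 2 * R / 4 ^ (k + 1)) atTop (𝓝 0) :=
    tendsto_const_nhds.div_atTop
      ((tendsto_pow_atTop_atTop_of_one_lt (by norm_num)).comp (tendsto_add_atTop_nat 1))
  have hV : Tendsto V atTop (𝓝 0) := by
    refine (ENNReal.tendsto_toReal ENNReal.zero_ne_top).comp
      (tendsto_volume_annularRegion R (r := fun k : ℕ => 2 * R / 4 ^ (k + 1)) ?_ hr0)
    intro i j hij
    simp only
    gcongr
    norm_num
  have hu := tendsto_sum_pow_mul_div_pow hV
  refine le_antisymm (ENNReal.le_of_forall_pos_le_add fun θ hθ _ => ?_) zero_le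
  rw [zero_add]
  -- write `ε = s ^ 10`, and choose `m` with `2 R / 4 ^ m` comparable to `η s ^ 2`
  obtain ⟨η, hη, hη3⟩ : ∃ η : ℝ, 0 < η ∧ 3 * η ≤ θ :=
    ⟨θ / 3, div_pos hθ three_pos, by linarith⟩
  -- Chosen so that the lower bound `η s² / 4` for the cutoff `2R / 4^(n+1)` becomes `2^(n+1) ≤ B /
  -- s`, that is `8^(n+1) ≤ B³ / s³`.
  set B := √(8 * R / η) with hB
  have hB0 : 0 < B := Real.sqrt_pos.2 (by positivity)
  obtain ⟨M, hM⟩ := eventually_atTop.1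
    (hu.eventually (gt_mem_nhds (show 0 < η / (C * B ^ 3) by positivity)))
  have hs0 : Tendsto (fun ε : ℝ => ε ^ (1 / 10 : ℝ)) (𝓝[>] 0) (𝓝 0) := by
    have := (Real.continuousAt_rpow_const 0 (1 / 10 : ℝ) (Or.inr (by norm_num))).tendsto
    rw [Real.zero_rpow (by norm_num)] at this
    exact this.mono_left nhdsWithin_le_nhds
  have ev1 : ∀ᶠ s : ℝ in 𝓝 0, 4 * s ^ 8 < η := by
    have : Tendsto (fun s : ℝ => 4 * s ^ 8) (𝓝 0) (𝓝 (4 * 0 ^ 8)) := (tendsto_id.pow 8).const_mul 4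
    exact this.eventually (gt_mem_nhds (by simpa using hη))
  have ev2 : ∀ᶠ s : ℝ in 𝓝 0, η * s ^ 2 < 2 * R / 4 ^ M := by
    have : Tendsto (fun s : ℝ => η * s ^ 2) (𝓝 0) (𝓝 (η * 0 ^ 2)) := (tendsto_id.pow 2).const_mul η
    exact this.eventually (gt_mem_nhds (by simp; positivity))
  refine limsup_le_of_le (by isBoundedDefault) ?_
  filter_upwards [hs0.eventually ev1, hs0.eventually ev2, self_mem_nhdsWithin] with ε h1 h2 hε
  have hε : 0 < ε := hε
  set s := ε ^ (1 / 10 : ℝ) with hs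
  have hspos : 0 < s := Real.rpow_pos_of_pos hε _
  have hs10 : ε = s ^ 10 := by
    rw [hs, ← Real.rpow_natCast, ← Real.rpow_mul hε.le]; norm_num
  have hs2 : ε ^ (1 - 4 / 5 : ℝ) = s ^ 2 := by
    rw [hs, ← Real.rpow_natCast, ← Real.rpow_mul hε.le]; norm_num
  have hs5 : √ε = s ^ 5 := by
    rw [hs10, show s ^ 10 = (s ^ 5) ^ 2 by ring, Real.sqrt_sq (by positivity)]
  have hx1 : η * s ^ 2 / (2 * R) ≤ 1 := by
    rw [div_le_one (by positivity)]
    exact h2.le.trans (div_le_self (by positivity) (one_le_pow₀ (by norm_num)))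
  -- The cutoff index is `m = n + 1`, the first for which `2R / 4^m` drops below `η s²`.
  obtain ⟨n, hn1, hn2⟩ := exists_nat_pow_near_of_lt_one (y := (1 / 4 : ℝ))
    (show 0 < η * s ^ 2 / (2 * R) by positivity) hx1 (by norm_num) (by norm_num)
  rw [lt_div_iff₀ (by positivity), one_div_pow, one_div_mul_eq_div] at hn1
  rw [div_le_iff₀ (by positivity), one_div_pow, one_div_mul_eq_div] at hn2
  have hM' : M ≤ n + 1 := by
    have h3 := hn1.trans h2
    rw [div_lt_div_iff_of_pos_left (by positivity) (by positivity) (by positivity)] at h3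
    exact ((pow_lt_pow_iff_right₀ (by norm_num : (1 : ℝ) < 4)).1 h3).le
  have hn3 : η * s ^ 2 / 4 ≤ 2 * R / 4 ^ (n + 1) := by
    rw [pow_succ 4, ← div_div]
    gcongr
  have hεn : ε ≤ 2 * R / 4 ^ (n + 1) := by
    refine le_trans ?_ hn3
    rw [hs10]
    nlinarith [mul_le_mul_of_nonneg_left h1.le (sq_nonneg s)]
  have h2n : (2 : ℝ) ^ (n + 1) ≤ B / s := by
    refine le_of_sq_le_sq ?_ (by positivity)
    rw [div_pow, hB, Real.sq_sqrt (by positivity), ← pow_mul, mul_comm (n + 1), pow_mul,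
      show (2 : ℝ) ^ 2 = 4 by norm_num, le_div_iff₀ (by positivity), le_div_iff₀ hη]
    rw [le_div_iff₀ (by positivity)] at hn3
    linarith
  have h8n : (8 : ℝ) ^ (n + 1) ≤ B ^ 3 / s ^ 3 := by
    rw [show (8 : ℝ) = 2 ^ 3 by norm_num, ← pow_mul, mul_comm 3, pow_mul, ← div_pow]
    gcongr
  have hun := (hM (n + 1) hM').le
  rw [div_le_div_iff₀ (by positivity) (by positivity)] at hun
  have hsum : C * √ε * ∑ k ∈ Finset.range (n + 1), 8 ^ k * V k ≤ η * s ^ 2 := by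
    rw [hs5]
    have h4 : C * B ^ 3 * ∑ k ∈ Finset.range (n + 1), 8 ^ k * V k ≤ η * (B ^ 3 / s ^ 3) := by
      calc _ = (∑ k ∈ Finset.range (n + 1), 8 ^ k * V k) * (C * B ^ 3) := mul_comm _ _
        _ ≤ η * 8 ^ (n + 1) := hun
        _ ≤ _ := by gcongr
    rw [mul_div_assoc', le_div_iff₀ (by positivity)] at h4
    refine le_of_mul_le_mul_left ?_ (show 0 < B ^ 3 by positivity)
    calc _ = C * B ^ 3 * (∑ k ∈ Finset.range (n + 1), 8 ^ k * V k) * s ^ 3 * s ^ 2 := by ring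
      _ ≤ η * B ^ 3 * s ^ 2 := by gcongr
      _ = _ := by ring
  have htotal := (measure_mono (μ := volume) (Metric.cthickening_subset_thickening'
    (by positivity) (show ε < 2 * ε by linarith) (criticalValues (distFun F)))).trans
      (hmain (n + 1) ε hε hεn)
  rw [hs2]
  refine ENNReal.div_le_of_le_mul (htotal.trans ?_)
  rw [← ENNReal.ofReal_coe_nnreal, ← ENNReal.ofReal_mul θ.coe_nonneg]
  refine ENNReal.ofReal_le_ofReal ?_
  have h5 : 4 * ε ≤ η * s ^ 2 := by
    rw [hs10]
    nlinarith [mul_le_mul_of_nonneg_left h1.le (sq_nonneg s)]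
  -- The three summands are the cutoff interval, its `2ε`-margins and the sum over scales.
  calc _ ≤ η * s ^ 2 + η * s ^ 2 + η * s ^ 2 := by gcongr
    _ = 3 * η * s ^ 2 := by ring
    _ ≤ _ := by gcongr

theorem hasMinkowskiContent_of_upper_eq_zero {s : ℝ} {A : Set ℝ}
    (h : upperMinkowskiContent s A = 0) : HasMinkowskiContent s A 0 :=
  ⟨le_antisymm ((liminf_le_limsup (by isBoundedDefault) (by isBoundedDefault)).trans h.le) zero_le,
    h⟩

theorem upperMinkowskiDim_le {s : ℝ≥0} {A : Set ℝ} (h : upperMinkowskiContent s A = 0) :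
    upperMinkowskiDim A ≤ s :=
  iInf₂_le s h

theorem upperMinkowskiDim_criticalValues_le (hF : IsCompact F) (hne : F.Nonempty) :
    upperMinkowskiDim (criticalValues (distFun F)) ≤ 4 / 5 := by
  have h := upperMinkowskiDim_le (s := 4 / 5) (A := criticalValues (distFun F)) (by
    push_cast
    exact upperMinkowskiContent_criticalValues hF hne)
  refine h.trans_eq ?_
  rw [ENNReal.coe_div (by norm_num)]
  norm_num

theorem criticalValues_nonempty (hne : F.Nonempty) : (criticalValues (distFun F)).Nonempty := by
  obtain ⟨a, ha⟩ := hne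
  exact ⟨_, a, mem_criticalPoints_of_mem ha, rfl⟩

/-- Eventually `λ(A) ≤ λ(A_ε) ≤ ε^(1-s)`, which tends to zero. This gives the null set needed to
compare interval lengths with gap lengths. -/
theorem volume_eq_zero_of_upperMinkowskiContent {s : ℝ} (hs : s < 1) {A : Set ℝ}
    (h : upperMinkowskiContent s A = 0) : volume A = 0 := by
  have h1 : ∀ᶠ ε : ℝ in 𝓝[>] 0,
      volume (Metric.cthickening ε A) / ENNReal.ofReal (ε ^ (1 - s)) < 1 :=
    eventually_lt_of_limsup_lt (h.trans_lt one_pos) (by isBoundedDefault)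
  have h2 : Tendsto (fun ε : ℝ => ENNReal.ofReal (ε ^ (1 - s))) (𝓝[>] 0) (𝓝 0) := by
    have := (Real.continuousAt_rpow_const 0 (1 - s) (Or.inr (by linarith))).tendsto
    rw [Real.zero_rpow (by linarith)] at this
    simpa using ENNReal.tendsto_ofReal (this.mono_left nhdsWithin_le_nhds)
  refine le_antisymm (ge_of_tendsto h2 ?_) zero_le
  filter_upwards [h1, self_mem_nhdsWithin] with ε h hε
  have hpos : 0 < ε ^ (1 - s) := Real.rpow_pos_of_pos hε _
  rw [ENNReal.div_lt_iff (Or.inl (by simpa using hpos)) (Or.inl ENNReal.ofReal_ne_top),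
    one_mul] at h
  exact (measure_mono (Metric.self_subset_cthickening A)).trans h.le

end Content

/-! ### Gap sums and subadditivity -/

section GapSum

theorem ENNReal.rpow_tsum_le_tsum_rpow {ι : Type*} (a : ι → ℝ≥0∞) {α : ℝ} (h0 : 0 < α)
    (h1 : α ≤ 1) : (∑' i, a i) ^ α ≤ ∑' i, a i ^ α := by
  have h : Tendsto (fun s : Finset ι => (∑ i ∈ s, a i) ^ α) atTop (𝓝 ((∑' i, a i) ^ α)) :=
    (ENNReal.continuous_rpow_const.tendsto _).comp ENNReal.summable.hasSum
  refine le_of_tendsto' h fun s => ?_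
  refine le_trans ?_ (ENNReal.sum_le_tsum s)
  classical
  induction s using Finset.induction_on with
  | empty => simp [h0]
  | insert i s hi ih =>
    rw [Finset.sum_insert hi, Finset.sum_insert hi]
    exact (ENNReal.rpow_add_le_add_rpow _ _ h0.le h1).trans (by gcongr)

variable {B : Set ℝ}

theorem gaps_nonempty {I : Set ℝ} (hI : I ∈ gaps B) : I.Nonempty := by
  obtain ⟨-, x, hx, rfl⟩ := hI
  exact ⟨x, mem_connectedComponentIn hx⟩

theorem gaps_countable (hB : IsClosed B) : (gaps B).Countable := by
  refine Set.PairwiseDisjoint.countable_of_isOpen (s := id) ?_ ?_ ?_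
  · rintro _ ⟨-, x, hx, rfl⟩ _ ⟨-, y, hy, rfl⟩ hne
    by_contra h
    rw [Function.onFun, Set.not_disjoint_iff] at h
    obtain ⟨z, hzx, hzy⟩ := h
    exact hne ((connectedComponentIn_eq hzx).trans (connectedComponentIn_eq hzy).symm)
  · rintro _ ⟨-, x, hx, rfl⟩
    exact hB.isOpen_compl.connectedComponentIn
  · intro I hI
    exact gaps_nonempty hI

theorem connectedComponentIn_subset_Ioo {u v x : ℝ} (hu : u ∈ B) (hv : v ∈ B)
    (hx : x ∈ Ioo u v) (hxB : x ∈ Bᶜ) : connectedComponentIn Bᶜ x ⊆ Ioo u v := by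
  have hord := (isPreconnected_connectedComponentIn (F := Bᶜ) (x := x)).ordConnected
  have hxI := mem_connectedComponentIn hxB
  intro y hy
  constructor
  · by_contra! h
    exact connectedComponentIn_subset _ _ (hord.out hy hxI ⟨h, hx.1.le⟩) hu
  · by_contra! h
    exact connectedComponentIn_subset _ _ (hord.out hxI hy ⟨hx.2.le, h⟩) hv

/-- Up to the null set `B`, the interval is the union of the gaps inside it, so its length is at
most their total length; subadditivity of the power finishes. -/
theorem volume_Ioo_rpow_le {α : ℝ} (h0 : 0 < α) (h1 : α ≤ 1) (hB : IsClosed B)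
    (hvol : volume B = 0) {u v : ℝ} (hu : u ∈ B) (hv : v ∈ B) :
    volume (Ioo u v) ^ α ≤
      ∑' I : {I : gaps B // (I : Set ℝ) ⊆ Ioo u v}, volume (I : Set ℝ) ^ α := by
  have : Countable (gaps B) := (gaps_countable hB).to_subtype
  refine le_trans ?_ (ENNReal.rpow_tsum_le_tsum_rpow _ h0 h1)
  gcongr
  have hsub : Ioo u v ⊆ B ∪ ⋃ I : {I : gaps B // (I : Set ℝ) ⊆ Ioo u v}, (I : Set ℝ) := by
    intro x hx
    by_cases hxB : x ∈ B
    · exact Or.inl hxB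
    · have hI := connectedComponentIn_subset_Ioo hu hv hx hxB
      exact Or.inr (mem_iUnion.2 ⟨⟨⟨connectedComponentIn Bᶜ x,
        (Metric.isBounded_Ioo u v).subset hI, x, hxB, rfl⟩, hI⟩, mem_connectedComponentIn hxB⟩)
  calc volume (Ioo u v) ≤ volume B + volume (⋃ I : {I : gaps B // (I : Set ℝ) ⊆ Ioo u v},
        (I : Set ℝ)) := (measure_mono hsub).trans (measure_union_le _ _)
    _ ≤ _ := by rw [hvol, zero_add]; exact measure_iUnion_le _

/-- Disjoint intervals with end points in a closed null set do not contribute more than the gaps. -/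
theorem tsum_volume_Ioo_rpow_le_gapSum {α : ℝ} (h0 : 0 < α) (h1 : α ≤ 1) (hB : IsClosed B)
    (hvol : volume B = 0) {ι : Type*} {u v : ι → ℝ} (hu : ∀ i, u i ∈ B) (hv : ∀ i, v i ∈ B)
    (hd : Pairwise (Function.onFun Disjoint fun i => Ioo (u i) (v i))) :
    ∑' i, volume (Ioo (u i) (v i)) ^ α ≤ gapSum α B := by
  calc ∑' i, volume (Ioo (u i) (v i)) ^ α
      ≤ ∑' i, ∑' I : {I : gaps B // (I : Set ℝ) ⊆ Ioo (u i) (v i)}, volume (I : Set ℝ) ^ α :=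
        ENNReal.tsum_le_tsum fun i => volume_Ioo_rpow_le h0 h1 hB hvol (hu i) (hv i)
    _ = ∑' p : Σ i, {I : gaps B // (I : Set ℝ) ⊆ Ioo (u i) (v i)}, volume (p.2 : Set ℝ) ^ α :=
        by rw [ENNReal.tsum_sigma']
    _ ≤ gapSum α B := by
      refine ENNReal.tsum_comp_le_tsum_of_injective
        (f := fun p : Σ i, {I : gaps B // (I : Set ℝ) ⊆ Ioo (u i) (v i)} => (p.2 : gaps B)) ?_
        (fun I => volume (I : Set ℝ) ^ α)
      rintro ⟨i, I, hI⟩ ⟨j, J, hJ⟩ hIJ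
      obtain rfl : I = J := hIJ
      obtain ⟨x, hx⟩ := gaps_nonempty I.2
      obtain rfl : i = j := by
        by_contra hij
        exact Set.disjoint_left.1 (hd hij) (hI hx) (hJ hx)
      rfl

end GapSum

/-! ### The example: stacked rows of vertical pairs -/

section Example

/-- The number of rows of scale `k` in the example. -/
def rowCount (k : ℕ) : ℕ := 2 ^ k

/-- The number of pairs of points in a row of scale `k`. -/
def rowLength (k : ℕ) : ℕ := 16 * ((k + 1) * (k + 2)) ^ 2 * (2 ^ k) ^ 3

/-- The smallest half-distance of a pair of points of scale `k`. -/
noncomputable def baseRadius (k : ℕ) : ℝ := 1 / (4 * ((k + 1) * (k + 2)) * 2 ^ k)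

/-- The half-distance of the `m`-th pair of points of scale `k`. -/
noncomputable def pairRadius (k m : ℕ) : ℝ := √(baseRadius k ^ 2 + m / (rowLength k : ℝ) ^ 2)

/-- The height of the `j`-th row of scale `k`. -/
noncomputable def rowHeight (k j : ℕ) : ℝ := -1 / (k + 1) + 4 * baseRadius k * j + 2 * baseRadius k

/-- The midpoint of the `m`-th pair of points of scale `k`. -/
noncomputable def pairCenter (k m : ℕ) : EuclideanSpace ℝ (Fin 2) :=
  !₂[((m % rowLength k : ℕ) : ℝ) / rowLength k, rowHeight k (m / rowLength k)]

/-- Half of the difference of the points of the `m`-th pair of scale `k`. -/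
noncomputable def pairOffset (k m : ℕ) : EuclideanSpace ℝ (Fin 2) := !₂[0, pairRadius k m]

/-- The union of all pairs of points. -/
noncomputable def pairSet : Set (EuclideanSpace ℝ (Fin 2)) :=
  {x | ∃ k m, m < rowCount k * rowLength k ∧
    (x = pairCenter k m + pairOffset k m ∨ x = pairCenter k m - pairOffset k m)}

theorem rowLength_pos (k : ℕ) : 0 < rowLength k := by unfold rowLength; positivity

theorem baseRadius_pos (k : ℕ) : 0 < baseRadius k := by unfold baseRadius; positivity

/-- This identity dictates the row length: over a whole scale the increments `m / n²` stay below
`ρ²`, so all radii stay within `[ρ, 2ρ]`. -/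
theorem rowCount_div_rowLength (k : ℕ) : (rowCount k : ℝ) / rowLength k = baseRadius k ^ 2 := by
  simp only [rowCount, rowLength, baseRadius]
  push_cast
  field_simp
  norm_num

/-- Rows at spacing `4ρ` exactly fill the strip between heights `-1/(k+1)` and `-1/(k+2)`, so the
strips of all scales stack up in a bounded region. -/
theorem four_mul_baseRadius_mul_rowCount (k : ℕ) :
    4 * baseRadius k * rowCount k = 1 / (k + 1) - 1 / (k + 2) := by
  simp only [rowCount, baseRadius]
  push_cast
  field_simp
  norm_num

theorem two_mul_baseRadius_le {k l : ℕ} (h : k < l) : 2 * baseRadius l ≤ baseRadius k := by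
  have h1 : (2 : ℝ) ^ k * 2 ≤ 2 ^ l := by
    rw [← pow_succ]
    exact pow_le_pow_right₀ (by norm_num) h
  have h2 : (k : ℝ) ≤ l := by exact_mod_cast h.le
  unfold baseRadius
  rw [mul_one_div, div_le_div_iff₀ (by positivity) (by positivity)]
  calc 2 * (4 * ((k + 1) * (k + 2)) * 2 ^ k) = 4 * (((k : ℝ) + 1) * (k + 2)) * (2 ^ k * 2) := by ring
    _ ≤ 4 * (((l : ℝ) + 1) * (l + 2)) * 2 ^ l := by gcongr
    _ = _ := by ring

theorem pairRadius_nonneg (k m : ℕ) : 0 ≤ pairRadius k m := Real.sqrt_nonneg _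

theorem pairRadius_sq (k m : ℕ) :
    pairRadius k m ^ 2 = baseRadius k ^ 2 + m / (rowLength k : ℝ) ^ 2 :=
  Real.sq_sqrt (by positivity)

theorem baseRadius_le_pairRadius (k m : ℕ) : baseRadius k ≤ pairRadius k m := by
  refine le_of_sq_le_sq ?_ (pairRadius_nonneg k m)
  rw [pairRadius_sq]
  have : 0 ≤ (m : ℝ) / (rowLength k : ℝ) ^ 2 := by positivity
  linarith

theorem pairRadius_le {k m : ℕ} (hm : m < rowCount k * rowLength k) :
    pairRadius k m ≤ 2 * baseRadius k := by
  have hn : (0 : ℝ) < rowLength k := by exact_mod_cast rowLength_pos k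
  refine le_of_sq_le_sq ?_ (by linarith [baseRadius_pos k])
  have h1 : (m : ℝ) / (rowLength k : ℝ) ^ 2 ≤ baseRadius k ^ 2 := by
    rw [← rowCount_div_rowLength, div_le_div_iff₀ (by positivity) hn]
    have : (m : ℝ) ≤ rowCount k * rowLength k := by exact_mod_cast hm.le
    nlinarith
  rw [pairRadius_sq]
  nlinarith [baseRadius_pos k]

theorem rowHeight_bounds {k j : ℕ} (hj : j < rowCount k) :
    -1 / (k + 1) ≤ rowHeight k j - 2 * baseRadius k ∧
      rowHeight k j + 2 * baseRadius k ≤ -1 / (k + 2) := by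
  have h := four_mul_baseRadius_mul_rowCount k
  have hr := baseRadius_pos k
  have h1 : ((j : ℝ) + 1) ≤ rowCount k := by exact_mod_cast hj
  have h2 := mul_le_mul_of_nonneg_left h1 (show 0 ≤ 4 * baseRadius k by linarith)
  have h3 : 0 ≤ 4 * baseRadius k * j := by positivity
  unfold rowHeight
  rw [neg_div, neg_div]
  constructor <;> linarith

theorem le_abs_rowHeight_sub {k j l i : ℕ} (hj : j < rowCount k) (hi : i < rowCount l)
    (h : ¬(k = l ∧ j = i)) :
    2 * baseRadius k + 2 * baseRadius l ≤ |rowHeight k j - rowHeight l i| := by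
  wlog hlt : k < l ∨ k = l ∧ j < i generalizing k j l i
  · rw [abs_sub_comm, add_comm]
    refine this hi hj (by omega) (by omega)
  rw [abs_sub_comm]
  refine le_trans ?_ (le_abs_self _)
  rcases hlt with hlt | ⟨rfl, hlt⟩
  · have h1 := (rowHeight_bounds hj).2
    have h2 := (rowHeight_bounds hi).1
    have h3 : (-1 : ℝ) / (k + 2) ≤ -1 / (l + 1) := by
      rw [neg_div, neg_div, neg_le_neg_iff]
      have : ((k : ℝ) + 1) ≤ l := by exact_mod_cast hlt
      exact one_div_le_one_div_of_le (by positivity) (by linarith)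
    linarith
  · have h1 : ((j : ℝ) + 1) ≤ i := by exact_mod_cast hlt
    have h2 := mul_le_mul_of_nonneg_left h1
      (show 0 ≤ 4 * baseRadius k by linarith [baseRadius_pos k])
    unfold rowHeight
    linarith

theorem div_rowLength_lt {k m : ℕ} (hm : m < rowCount k * rowLength k) :
    m / rowLength k < rowCount k := Nat.div_lt_of_lt_mul (by rwa [mul_comm])

/-- The disc spanned by a pair contains no point of the set in its interior; `σ = ±1` selects an
endpoint of the other pair. In one row the vertical offset contributes exactly the other radius
squared, so the horizontal offset must pay for `(m - i) / n²`. In different rows the vertical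
separation exceeds the sum of the radii or equals it. -/
theorem pairRadius_le_norm {k m l i : ℕ} (hm : m < rowCount k * rowLength k)
    (hi : i < rowCount l * rowLength l) {σ : ℝ} (hσ : |σ| = 1) :
    pairRadius k m ≤ ‖pairCenter k m - (pairCenter l i + σ • pairOffset l i)‖ := by
  refine le_of_sq_le_sq ?_ (norm_nonneg _)
  rw [EuclideanSpace.norm_sq_eq, Fin.sum_univ_two]
  simp only [pairCenter, pairOffset, PiLp.sub_apply, PiLp.add_apply, PiLp.smul_apply, smul_eq_mul,
    Real.norm_eq_abs, sq_abs, Matrix.cons_val_zero, Matrix.cons_val_one, mul_zero, add_zero]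
  have hσ2 : σ ^ 2 = 1 := by rw [← sq_abs, hσ]; norm_num
  by_cases h : k = l ∧ m / rowLength k = i / rowLength l
  · obtain ⟨rfl, h⟩ := h
    have hn : (0 : ℝ) < rowLength k := by exact_mod_cast rowLength_pos k
    rw [← h]
    have e1 : (rowHeight k (m / rowLength k) - (rowHeight k (m / rowLength k) +
        σ * pairRadius k i)) ^ 2 = pairRadius k i ^ 2 := by
      linear_combination pairRadius k i ^ 2 * hσ2
    rw [e1, pairRadius_sq, pairRadius_sq, ← sub_div, div_pow]
    -- Equal quotients reduce the difference of indices to that of the horizontal positions; the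
    -- integer inequality `t ≤ t²` then suffices.
    have h3 : (m : ℤ) - i = ((m % rowLength k : ℕ) : ℤ) - (i % rowLength k : ℕ) := by
      have h1 := Nat.mod_add_div m (rowLength k)
      have h2 := Nat.mod_add_div i (rowLength k)
      rw [← h] at h2
      omega
    have h4 : (m : ℤ) - i ≤ (((m % rowLength k : ℕ) : ℤ) - (i % rowLength k : ℕ)) ^ 2 := by
      rw [h3]
      exact Int.le_self_sq _
    have h5 : (m : ℝ) - i ≤ (((m % rowLength k : ℕ) : ℝ) - (i % rowLength k : ℕ)) ^ 2 := by
      exact_mod_cast h4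
    have h6 : (m : ℝ) / (rowLength k : ℝ) ^ 2 - i / (rowLength k : ℝ) ^ 2 ≤
        (((m % rowLength k : ℕ) : ℝ) - (i % rowLength k : ℕ)) ^ 2 / (rowLength k : ℝ) ^ 2 := by
      rw [← sub_div]
      gcongr
    linarith
  · have h1 := le_abs_rowHeight_sub (div_rowLength_lt hm) (div_rowLength_lt hi) h
    have h2 := pairRadius_le hm
    have h3 := pairRadius_le hi
    have h4 : pairRadius k m ≤ |rowHeight k (m / rowLength k) -
        (rowHeight l (i / rowLength l) + σ * pairRadius l i)| := by
      have := abs_sub_abs_le_abs_sub (rowHeight k (m / rowLength k) - rowHeight l (i / rowLength l))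
        (σ * pairRadius l i)
      rw [abs_mul, hσ, one_mul, abs_of_nonneg (pairRadius_nonneg l i)] at this
      rw [← sub_sub]
      linarith
    have h5 := pow_le_pow_left₀ (pairRadius_nonneg k m) h4 2
    rw [sq_abs] at h5
    nlinarith [sq_nonneg (((m % rowLength k : ℕ) : ℝ) / rowLength k -
      ((i % rowLength l : ℕ) : ℝ) / rowLength l)]

theorem norm_pairOffset (k m : ℕ) : ‖pairOffset k m‖ = pairRadius k m := by
  rw [← sq_eq_sq₀ (norm_nonneg _) (pairRadius_nonneg k m), EuclideanSpace.norm_sq_eq]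
  simp [pairOffset, Fin.sum_univ_two]

theorem pairRadius_mem_criticalValues {k m : ℕ} (hm : m < rowCount k * rowLength k) :
    pairRadius k m ∈ criticalValues (distFun (closure pairSet)) := by
  have hmem : pairCenter k m + pairOffset k m ∈ pairSet := ⟨k, m, hm, Or.inl rfl⟩
  have hmem' : pairCenter k m - pairOffset k m ∈ pairSet := ⟨k, m, hm, Or.inr rfl⟩
  have hd : distFun (closure pairSet) (pairCenter k m) = pairRadius k m := by
    unfold distFun
    rw [Metric.infDist_closure]
    refine le_antisymm ?_ ((Metric.le_infDist ⟨_, hmem⟩).2 ?_)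
    · refine (Metric.infDist_le_dist_of_mem hmem).trans_eq ?_
      simp [norm_pairOffset]
    · rintro _ ⟨l, i, hi, rfl | rfl⟩
      · simpa [dist_eq_norm] using pairRadius_le_norm hm hi (σ := 1) (by simp)
      · simpa [dist_eq_norm, sub_eq_add_neg] using pairRadius_le_norm hm hi (σ := -1) (by simp)
  exact ⟨pairCenter k m, mem_criticalPoints_of_opposite (subset_closure hmem)
    (subset_closure hmem') (by rw [hd, norm_pairOffset]), hd⟩

theorem rowCount_mul_rowLength_ge (k : ℕ) : 16 ≤ rowCount k * rowLength k := by
  have h1 : 0 < rowCount k := by unfold rowCount; positivity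
  have h2 : 16 ≤ rowLength k := by
    unfold rowLength
    rw [mul_assoc]
    exact Nat.le_mul_of_pos_right _ (by positivity)
  nlinarith

theorem pairSet_nonempty : pairSet.Nonempty :=
  ⟨_, 0, 0, by linarith [rowCount_mul_rowLength_ge 0], Or.inl rfl⟩

theorem isBounded_pairSet : Bornology.IsBounded pairSet := by
  rw [isBounded_iff_forall_norm_le]
  refine ⟨3, ?_⟩
  have hr : ∀ k, baseRadius k ≤ 1 / 8 := by
    intro k
    unfold baseRadius
    have h1 : (1 : ℝ) ≤ 2 ^ k := one_le_pow₀ (by norm_num)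
    have h2 : (0 : ℝ) ≤ k := k.cast_nonneg
    refine one_div_le_one_div_of_le (by norm_num) ?_
    nlinarith [mul_nonneg h2 h2]
  have hc : ∀ k m, m < rowCount k * rowLength k → ‖pairCenter k m‖ ≤ 2 := by
    intro k m hm
    have hn : (0 : ℝ) < rowLength k := by exact_mod_cast rowLength_pos k
    refine le_of_sq_le_sq ?_ (by norm_num)
    rw [EuclideanSpace.norm_sq_eq, Fin.sum_univ_two]
    simp only [pairCenter, Real.norm_eq_abs, sq_abs, Matrix.cons_val_zero, Matrix.cons_val_one]
    have h1 : ((m % rowLength k : ℕ) : ℝ) / rowLength k ≤ 1 := by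
      rw [div_le_one hn]
      exact_mod_cast (Nat.mod_lt m (rowLength_pos k)).le
    have h0 : 0 ≤ ((m % rowLength k : ℕ) : ℝ) / rowLength k := by positivity
    obtain ⟨h2, h3⟩ := rowHeight_bounds (div_rowLength_lt hm)
    have h4 : (-1 : ℝ) ≤ -1 / (k + 1) := by
      rw [le_div_iff₀ (by positivity)]
      linarith [(Nat.cast_nonneg k : (0 : ℝ) ≤ k)]
    have h5 : (-1 : ℝ) / (k + 2) ≤ 0 := div_nonpos_of_nonpos_of_nonneg (by norm_num) (by positivity)
    have h6 := baseRadius_pos k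
    nlinarith
  rintro _ ⟨k, m, hm, rfl | rfl⟩
  · refine (norm_add_le _ _).trans ?_
    rw [norm_pairOffset]
    linarith [hc k m hm, pairRadius_le hm, hr k]
  · refine (norm_sub_le _ _).trans ?_
    rw [norm_pairOffset]
    linarith [hc k m hm, pairRadius_le hm, hr k]

end Example

/-! ### Gap sum and dimension of the example -/

section ExampleValues

/-- The critical values of the distance function from the closure of `pairSet`. -/
noncomputable def pairValues : Set ℝ := criticalValues (distFun (closure pairSet))

theorem isCompact_closure_pairSet : IsCompact (closure pairSet) :=
  isBounded_pairSet.isCompact_closure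

theorem isClosed_pairValues : IsClosed pairValues :=
  (isCompact_criticalValues isCompact_closure_pairSet pairSet_nonempty.closure).isClosed

theorem volume_pairValues : volume pairValues = 0 :=
  volume_eq_zero_of_upperMinkowskiContent (by norm_num)
    (upperMinkowskiContent_criticalValues isCompact_closure_pairSet pairSet_nonempty.closure)

/-- A lower bound for the distance of consecutive critical values of scale `k`. -/
noncomputable def stepSize (k : ℕ) : ℝ :=
  1 / (256 * (((k : ℝ) + 1) * (k + 2)) ^ 3 * (2 ^ k) ^ 5)

theorem stepSize_pos (k : ℕ) : 0 < stepSize k := by unfold stepSize; positivity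

theorem four_mul_baseRadius_mul_stepSize (k : ℕ) :
    4 * baseRadius k * stepSize k = 1 / (rowLength k : ℝ) ^ 2 := by
  simp only [baseRadius, stepSize, rowLength]
  push_cast
  field_simp
  norm_num

/-- The squares of consecutive radii differ by `1 / n²` and their sum lies in `[2ρ, 4ρ]`, which
confines each step to between `stepSize` and twice it. -/
theorem pairRadius_succ_sub_mul (k m : ℕ) :
    (pairRadius k (m + 1) - pairRadius k m) * (pairRadius k (m + 1) + pairRadius k m) =
      4 * baseRadius k * stepSize k := by
  have h : (pairRadius k (m + 1) - pairRadius k m) * (pairRadius k (m + 1) + pairRadius k m) =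
      pairRadius k (m + 1) ^ 2 - pairRadius k m ^ 2 := by ring
  rw [h, pairRadius_sq, pairRadius_sq, four_mul_baseRadius_mul_stepSize]
  push_cast
  ring

theorem stepSize_le {k m : ℕ} (hm : m + 1 < rowCount k * rowLength k) :
    stepSize k ≤ pairRadius k (m + 1) - pairRadius k m := by
  have h := pairRadius_succ_sub_mul k m
  have hr := baseRadius_pos k
  have h1 := pairRadius_le hm
  have h2 := pairRadius_le (Nat.lt_of_succ_lt hm)
  have h3 := baseRadius_le_pairRadius k m
  have h4 := baseRadius_le_pairRadius k (m + 1)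
  have hs := stepSize_pos k
  by_contra! hlt
  nlinarith

theorem pairRadius_succ_sub_le (k m : ℕ) :
    pairRadius k (m + 1) - pairRadius k m ≤ 2 * stepSize k := by
  have h := pairRadius_succ_sub_mul k m
  have hr := baseRadius_pos k
  have h3 := baseRadius_le_pairRadius k m
  have h4 := baseRadius_le_pairRadius k (m + 1)
  have hs := stepSize_pos k
  by_contra! hlt
  nlinarith

theorem pairRadius_mono (k : ℕ) : Monotone (pairRadius k) := by
  intro i j hij
  unfold pairRadius
  gcongr

theorem disjoint_pairRadius_Ioo {k m l i : ℕ} (hm : m + 1 < rowCount k * rowLength k)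
    (hi : i + 1 < rowCount l * rowLength l) (h : ¬(k = l ∧ m = i)) :
    Disjoint (Ioo (pairRadius k m) (pairRadius k (m + 1)))
      (Ioo (pairRadius l i) (pairRadius l (i + 1))) := by
  wlog hlt : k < l ∨ k = l ∧ m < i generalizing k m l i
  · exact (this hi hm (by omega) (by omega)).symm
  rw [Set.disjoint_left]
  rintro x ⟨hx1, hx2⟩ ⟨hx3, hx4⟩
  rcases hlt with hlt | ⟨rfl, hlt⟩
  -- Different scales occupy separate ranges: radii of the finer scale `l` are at most `2ρ_l ≤ ρ_k`.
  · linarith [two_mul_baseRadius_le hlt, baseRadius_le_pairRadius k m, pairRadius_le hi]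
  · linarith [pairRadius_mono k (Nat.succ_le_of_lt hlt)]

/-- The exact power of `k + 2` would be `24/5`; rounding it up to `5` keeps the exponents integral
after taking fifth powers and still leaves a divergent harmonic series. -/
theorem le_stepSize_rpow (k : ℕ) :
    1 / ((4 * 2 ^ k) ^ 4 * ((k : ℝ) + 2) ^ 5) ≤ stepSize k ^ (4 / 5 : ℝ) := by
  have hs := stepSize_pos k
  refine le_of_pow_le_pow_left₀ (n := 5) (by norm_num) (by positivity) ?_
  rw [← Real.rpow_natCast (stepSize k ^ (4 / 5 : ℝ)), ← Real.rpow_mul hs.le]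
  rw [show (4 / 5 : ℝ) * ((5 : ℕ) : ℝ) = ((4 : ℕ) : ℝ) by norm_num, Real.rpow_natCast]
  unfold stepSize
  rw [one_div_pow, one_div_pow]
  refine one_div_le_one_div_of_le (by positivity) ?_
  have hk : (0 : ℝ) ≤ k := k.cast_nonneg
  calc (256 * (((k : ℝ) + 1) * (k + 2)) ^ 3 * (2 ^ k) ^ 5) ^ 4
      ≤ (256 * (((k : ℝ) + 2) * (k + 2)) ^ 3 * (2 ^ k) ^ 5) ^ 4 := by gcongr; norm_num
    _ ≤ (256 * (((k : ℝ) + 2) * (k + 2)) ^ 3 * (2 ^ k) ^ 5) ^ 4 * (256 * (k + 2)) :=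
        le_mul_of_one_le_right (by positivity) (by linarith)
    _ = ((4 * 2 ^ k) ^ 4 * ((k : ℝ) + 2) ^ 5) ^ 5 := by ring

theorem le_sum_stepSize_rpow (k : ℕ) :
    1 / (128 * ((k : ℝ) + 2)) ≤
      ((rowCount k * rowLength k - 1 : ℕ) : ℝ) * stepSize k ^ (4 / 5 : ℝ) := by
  have h16 := rowCount_mul_rowLength_ge k
  have h1 : ((rowCount k * rowLength k : ℕ) : ℝ) / 2 ≤ ((rowCount k * rowLength k - 1 : ℕ) : ℝ) := by
    rw [Nat.cast_sub (by omega)]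
    have : (16 : ℝ) ≤ ((rowCount k * rowLength k : ℕ) : ℝ) := by exact_mod_cast h16
    push_cast at this ⊢
    linarith
  have hk : (0 : ℝ) ≤ k := k.cast_nonneg
  refine le_trans ?_ (mul_le_mul h1 (le_stepSize_rpow k) (by positivity) (by positivity))
  simp only [rowCount, rowLength]
  push_cast
  rw [mul_one_div, div_le_div_iff₀ (by positivity) (by positivity)]
  have e : (2 : ℝ) ^ k * (16 * (((k : ℝ) + 1) * (k + 2)) ^ 2 * (2 ^ k) ^ 3) / 2 *
      (128 * (k + 2)) - 1 * ((4 * 2 ^ k) ^ 4 * (k + 2) ^ 5) =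
      256 * (2 ^ k) ^ 4 * (k + 2) ^ 3 * ((2 * (k + 1)) ^ 2 - (k + 2) ^ 2) := by ring
  have h2 : (0 : ℝ) ≤ (2 * (k + 1)) ^ 2 - (k + 2) ^ 2 := by nlinarith
  have h3 : (0 : ℝ) ≤ 256 * (2 ^ k) ^ 4 * (k + 2) ^ 3 * ((2 * (k + 1)) ^ 2 - (k + 2) ^ 2) :=
    mul_nonneg (by positivity) h2
  linarith

theorem tsum_harmonic_eq_top : ∑' k : ℕ, ENNReal.ofReal (1 / (128 * ((k : ℝ) + 2))) = ⊤ := by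
  by_contra h
  have h1 := ENNReal.summable_toReal h
  have h2 : Summable fun k : ℕ => 1 / (128 * ((k : ℝ) + 2)) :=
    h1.congr fun k => ENNReal.toReal_ofReal (by positivity)
  refine Real.not_summable_one_div_natCast ((summable_nat_add_iff 2).1 ?_)
  refine (h2.mul_left 128).congr fun k => ?_
  push_cast
  field_simp

theorem gapSum_pairValues : gapSum (4 / 5) pairValues = ⊤ := by
  have h := tsum_volume_Ioo_rpow_le_gapSum (α := 4 / 5) (by norm_num) (by norm_num)
    isClosed_pairValues volume_pairValues
    -- A scale with `N` radii has `N - 1` intervals between consecutive ones. Intervals joining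
    -- different scales are not needed.
    (ι := Σ k, Fin (rowCount k * rowLength k - 1))
    (u := fun p => pairRadius p.1 p.2) (v := fun p => pairRadius p.1 (p.2 + 1))
    (fun p => pairRadius_mem_criticalValues (by omega))
    (fun p => pairRadius_mem_criticalValues (by omega)) (by
      rintro ⟨k, m⟩ ⟨l, i⟩ hne
      refine disjoint_pairRadius_Ioo (by omega) (by omega) ?_
      rintro ⟨hkl, hmi⟩
      obtain rfl : k = l := hkl
      exact hne (congrArg _ (Fin.ext hmi)))
  rw [eq_top_iff]
  refine le_trans ?_ h
  rw [ENNReal.tsum_sigma', ← tsum_harmonic_eq_top]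
  refine ENNReal.tsum_le_tsum fun k => ?_
  rw [tsum_fintype]
  calc ENNReal.ofReal (1 / (128 * ((k : ℝ) + 2)))
      ≤ ENNReal.ofReal (((rowCount k * rowLength k - 1 : ℕ) : ℝ) * stepSize k ^ (4 / 5 : ℝ)) :=
        ENNReal.ofReal_le_ofReal (le_sum_stepSize_rpow k)
    _ = ∑ m : Fin (rowCount k * rowLength k - 1), ENNReal.ofReal (stepSize k) ^ (4 / 5 : ℝ) := by
        rw [ENNReal.ofReal_mul (by positivity), ENNReal.ofReal_natCast,
          ENNReal.ofReal_rpow_of_pos (stepSize_pos k)]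
        simp
    _ ≤ _ := by
        refine Finset.sum_le_sum fun m _ => ?_
        rw [Real.volume_Ioo]
        gcongr
        have hm : (m : ℕ) + 1 < rowCount k * rowLength k := by omega
        exact stepSize_le hm

theorem Icc_subset_cthickening {A : Set ℝ} {a : ℕ → ℝ} {δ : ℝ} {M : ℕ}
    (hA : ∀ m ≤ M, a m ∈ A) (ha : ∀ m < M, a (m + 1) - a m ≤ δ) :
    Icc (a 0) (a M) ⊆ Metric.cthickening δ A := by
  induction M with
  | zero =>
    intro x hx
    have : x = a 0 := le_antisymm hx.2 hx.1
    exact Metric.self_subset_cthickening A (this ▸ hA 0 le_rfl)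
  | succ M ih =>
    intro x hx
    rcases le_total x (a M) with h | h
    · exact ih (fun m hm => hA m (hm.trans M.le_succ)) (fun m hm => ha m (hm.trans M.lt_succ_self))
        ⟨hx.1, h⟩
    · refine Metric.mem_cthickening_of_dist_le x (a M) δ A (hA M M.le_succ) ?_
      rw [Real.dist_eq, abs_of_nonneg (by linarith)]
      linarith [ha M M.lt_succ_self, hx.2]

/-- Neighbourhoods of size twice the step bridge all radii of scale `k`, whose range reaches at
least from `ρ` to `6ρ/5`, as the last squared radius is at least `3ρ²/2`. This bounds the dimension
directly, without passing through the gap sum. -/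
theorem le_volume_cthickening_pairValues (k : ℕ) :
    ENNReal.ofReal (baseRadius k / 5) ≤
      volume (Metric.cthickening (2 * stepSize k) pairValues) := by
  have h16 := rowCount_mul_rowLength_ge k
  have hr := baseRadius_pos k
  have hsub := Icc_subset_cthickening (A := pairValues) (a := pairRadius k) (δ := 2 * stepSize k)
    (M := rowCount k * rowLength k - 1)
    (fun m hm => pairRadius_mem_criticalValues (by omega))
    (fun m _ => pairRadius_succ_sub_le k m)
  refine le_trans ?_ (measure_mono hsub)
  rw [Real.volume_Icc]
  refine ENNReal.ofReal_le_ofReal ?_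
  have h0 : pairRadius k 0 = baseRadius k := by
    simp [pairRadius, Real.sqrt_sq hr.le]
  have hn : (0 : ℝ) < rowLength k := by exact_mod_cast rowLength_pos k
  have h1 : 6 / 5 * baseRadius k ≤ pairRadius k (rowCount k * rowLength k - 1) := by
    refine le_of_sq_le_sq ?_ (pairRadius_nonneg _ _)
    have h2 : baseRadius k ^ 2 / 2 ≤
        ((rowCount k * rowLength k - 1 : ℕ) : ℝ) / (rowLength k : ℝ) ^ 2 := by
      rw [← rowCount_div_rowLength, div_div, div_le_div_iff₀ (by positivity) (by positivity),
        Nat.cast_sub (by omega)]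
      have : (16 : ℝ) ≤ ((rowCount k * rowLength k : ℕ) : ℝ) := by exact_mod_cast h16
      push_cast at this ⊢
      nlinarith
    rw [pairRadius_sq]
    nlinarith
  linarith

theorem four_fifths_le_of_upperMinkowskiContent_pairValues {t : ℝ}
    (h : upperMinkowskiContent t pairValues = 0) : 4 / 5 ≤ t := by
  by_contra! ht
  have hev : ∀ᶠ ε : ℝ in 𝓝[>] 0,
      volume (Metric.cthickening ε pairValues) / ENNReal.ofReal (ε ^ (1 - t)) < 1 :=
    eventually_lt_of_limsup_lt (h.trans_lt one_pos) (by isBoundedDefault)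
  have hstep : ∀ k, 2 * stepSize k ≤ ((1 / 2) ^ k) ^ 5 := by
    intro k
    have hk : (0 : ℝ) ≤ k := k.cast_nonneg
    unfold stepSize
    rw [one_div_pow, one_div_pow, mul_one_div]
    rw [div_le_div_iff₀ (by positivity) (by positivity), one_mul]
    have : (1 : ℝ) ≤ (((k : ℝ) + 1) * (k + 2)) ^ 3 := one_le_pow₀ (by nlinarith)
    have h2 : (0 : ℝ) < (2 ^ k) ^ 5 := by positivity
    nlinarith
  have hlim : Tendsto (fun k => 2 * stepSize k) atTop (𝓝[>] 0) := by
    refine tendsto_nhdsWithin_iff.2 ⟨?_, Eventually.of_forall fun k => ?_⟩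
    · refine squeeze_zero (fun k => by linarith [stepSize_pos k]) hstep ?_
      have := (tendsto_pow_atTop_nhds_zero_of_lt_one (r := (1 / 2 : ℝ)) (by norm_num)
        (by norm_num)).pow 5
      simpa using this
    · have := stepSize_pos k
      simpa using this
  -- At `ε` at most `2^(-5k)`, the bound `ε^(1-t)` is at most `2^(-k) x^k`, and `x < 1` exactly when
  -- `t < 4/5`. The neighbourhood has measure at least `2^(-k)` divided by a polynomial in `k`, a
  -- contradiction for large `k`.
  set x : ℝ := (1 / 2) ^ (5 * (1 - t) - 1) with hx
  have hx0 : 0 < x := Real.rpow_pos_of_pos (by norm_num) _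
  have hx1 : x < 1 := Real.rpow_lt_one (by norm_num) (by norm_num) (by linarith)
  have hzero : Tendsto (fun k : ℕ => 20 * (((k : ℝ) + 1) * (k + 2)) * x ^ k) atTop (𝓝 0) := by
    have h2 := tendsto_pow_const_mul_const_pow_of_abs_lt_one 2 (r := x) (by rwa [abs_of_pos hx0])
    have h1 := tendsto_pow_const_mul_const_pow_of_abs_lt_one 1 (r := x) (by rwa [abs_of_pos hx0])
    have h0 := tendsto_pow_const_mul_const_pow_of_abs_lt_one 0 (r := x) (by rwa [abs_of_pos hx0])
    have := ((h2.const_mul 20).add (h1.const_mul 60)).add (h0.const_mul 40)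
    simp only [mul_zero, add_zero] at this
    refine this.congr fun k => ?_
    ring
  obtain ⟨k, hk1, hk2⟩ := ((hlim.eventually hev).and
    (hzero.eventually (gt_mem_nhds one_pos))).exists
  have hs : 0 < 2 * stepSize k := by linarith [stepSize_pos k]
  have hpos : 0 < (2 * stepSize k) ^ (1 - t) := Real.rpow_pos_of_pos hs _
  rw [ENNReal.div_lt_iff (Or.inl (by simpa using hpos)) (Or.inl ENNReal.ofReal_ne_top),
    one_mul] at hk1
  have h3 := (le_volume_cthickening_pairValues k).trans_lt hk1
  rw [ENNReal.ofReal_lt_ofReal_iff hpos] at h3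
  have h4 : (2 * stepSize k) ^ (1 - t) ≤ (1 / 2) ^ k * x ^ k := by
    refine (Real.rpow_le_rpow hs.le (hstep k) (by linarith)).trans_eq ?_
    rw [← pow_mul, ← Real.rpow_natCast, ← Real.rpow_mul (by norm_num), ← mul_pow, hx,
      ← Real.rpow_one_add' (by norm_num) (by linarith), ← Real.rpow_natCast,
      ← Real.rpow_mul (by norm_num)]
    congr 1
    push_cast
    ring
  have h5 := h3.trans_le h4
  unfold baseRadius at h5
  have h6 : (1 : ℝ) / (4 * ((k + 1) * (k + 2)) * 2 ^ k) / 5 =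
      (1 / 2) ^ k * (1 / (20 * (((k : ℝ) + 1) * (k + 2)))) := by
    rw [one_div_pow]
    field_simp
    norm_num
  rw [h6, mul_lt_mul_iff_right₀ (by positivity), div_lt_iff₀ (by positivity)] at h5
  linarith

theorem upperMinkowskiDim_pairValues : upperMinkowskiDim pairValues = 4 / 5 := by
  refine le_antisymm
    (upperMinkowskiDim_criticalValues_le isCompact_closure_pairSet pairSet_nonempty.closure) ?_
  refine le_iInf₂ fun t ht => ?_
  have h := four_fifths_le_of_upperMinkowskiContent_pairValues ht
  have h' : (4 / 5 : ℝ≥0) ≤ t := by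
    rw [← NNReal.coe_le_coe]
    push_cast
    exact h
  calc (4 / 5 : ℝ≥0∞) = ((4 / 5 : ℝ≥0) : ℝ≥0∞) := by
        rw [ENNReal.coe_div (by norm_num)]; norm_num
    _ ≤ t := by exact_mod_cast h'

end ExampleValues

theorem theorem45 :
    (∀ F : Set (EuclideanSpace ℝ (Fin 2)), F.Nonempty → IsCompact F →
      ((criticalValues (distFun F)).Nonempty ∧ IsCompact (criticalValues (distFun F))) ∧
      HasMinkowskiContent (4 / 5) (criticalValues (distFun F)) 0 ∧
      upperMinkowskiDim (criticalValues (distFun F)) ≤ 4 / 5) ∧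
    (∃ F : Set (EuclideanSpace ℝ (Fin 2)), F.Nonempty ∧ IsCompact F ∧
      gapSum (4 / 5) (criticalValues (distFun F)) = ⊤ ∧
      upperMinkowskiDim (criticalValues (distFun F)) = 4 / 5) := by
  refine ⟨fun F hne hF => ⟨⟨criticalValues_nonempty hne, isCompact_criticalValues hF hne⟩,
    hasMinkowskiContent_of_upper_eq_zero (upperMinkowskiContent_criticalValues hF hne),
    upperMinkowskiDim_criticalValues_le hF hne⟩, closure pairSet, pairSet_nonempty.closure,
    isCompact_closure_pairSet, gapSum_pairValues, upperMinkowskiDim_pairValues⟩
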